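/- For each pair of sample sizes $(N,T)$ let returns $r_{it}$ ($i\le N$, $t\le T$) and observed factors $F_t\in\mathbb R^{k_F}$ obey $$r_{it}=\lambda'\beta_i+(F_t-EF_t)'\beta_i+v_t'\mu_i+e_{it},$$ where $v_t\in\mathbb R^{k_v}$ (unobserved factors, $k_v\ge 0$) has mean zero and is uncorrelated with $F_t$, and $e_{it}$ has mean zero and is uncorrelated with $F_t$ and $v_t$. The loadings $\beta_i,\mu_i$ are nonrandom and, like the joint law of the data, may change with $(N,T)$; $\lambda$ and $\Sigma_F$ are fixed. Put $\widetilde F_t=F_t-\frac1T\sum_sF_s$, $\mathcal F=\sigma(F_1,\dots,F_T,v_1,\dots,v_T)$, and $\gamma_i'=(\beta_i',\mu_i')$ (all observed factors are strong, $k_2=0$). Assume: FACTORS. $(F_t)$ is stationary with finite fourth moments and full-rank covariance matrix $\Sigma_F$; $\frac1T\sum_t\widetilde F_t\widetilde F_t'\to^p\Sigma_F$; and, jointly, $$\Big(\tfrac1{\sqrt T}\sum_t(F_t-EF_t),\ \eta_T=\tfrac1{\sqrt T}\sum_t\Sigma_F^{-1}\widetilde F_tv_t',\ \eta_{v,T}=\tfrac1{\sqrt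 T}\sum_tv_t\Big)\Rightarrow(Z,\eta,\eta_v),$$ with $Z\sim N(0,\Omega_F)$, $\mathrm{vec}(\eta)\sim N(0,\Omega_{vF})$, $\eta_v\sim N(0,I_{k_v})$. LOADINGS. $\frac1N\sum_i\gamma_i\gamma_i'\to\Gamma$ with $\Gamma$ positive definite, and $\sup_{N,T}\frac1N\sum_i\|\gamma_i\|^4<\infty$. ERRORS. (i) Conditionally on $\mathcal F$ the vectors $e_t=(e_{1t},\dots,e_{Nt})'$, $t\le T$, are independent with $E(e_t|\mathcal F)=0$. (ii) With $\rho(t,s)=\frac1{\sqrt N}\sum_ie_{it}e_{is}$, $E[(1+\|F_t\|^4)(\rho(s,t)^2+1)]\le C$ for all $s\ne t$ and all $N,T$. (iii) With $S_t=\frac1N\sum_ie_{it}^2$, $\frac{\sqrt N}T\sum_t\widetilde F_tS_t\to^p0$ and $\frac1T\sum_t\widetilde F_t\widetilde F_t'S_t\to^p\Sigma_{SF^2}$ for some constant matrix $\Sigma_{SF^2}$. (iv) With $W_t=\frac1{\sqrt N}\sum_i\gamma_ie_{it}$, $E[(1+\|F_t\|^2)\|W_t\|^2]\le C$ for all $t,N,T$.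 Let $\widehat\beta_i=(\sum_t\widetilde F_t\widetilde F_t')^{-1}\sum_t\widetilde F_tr_{it}$ and let $\widehat\lambda_{TP}=(\sum_i\widehat\beta_i\widehat\beta_i')^{-1}\sum_i\widehat\beta_i\bar r_i$, with $\bar r_i=\frac1T\sum_tr_{it}$, be the two-pass estimator; put $\widetilde\lambda=\lambda+\frac1T\sum_tF_t-EF_t$. Then, as $N,T\to\infty$ jointly without restriction on their relative rates, $$\sqrt T(\widehat\lambda_{TP}-\lambda)\Rightarrow\Gamma_{\beta\beta}^{-1}\Gamma_{\beta\mu}(\eta_v-\eta'\lambda)+Z,\qquad \sqrt T(\widetilde\lambda-\lambda)\Rightarrow Z\sim N(0,\Omega_F),$$ where $\Gamma_{\beta\beta},\Gamma_{\beta\mu}$ are the blocks of $\Gamma$. The limit of $\sqrt T(\widehat\lambda_{TP}-\lambda)$ has mean zero, and it is Gaussian, as is $\Gamma_{\beta\beta}^{-1}\Gamma_{\beta\mu}(\eta_v-\eta'\lambda)$, whenever $(Z,\mathrm{vec}(\eta),\eta_v)$ is jointly Gaussian. If in addition there are no missing factors ($\mu_i=0$ for all $i,N,T$; since $\Gamma$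 is positive definite this means $k_v=0$), then $\sqrt T(\widehat\lambda_{TP}-\lambda)=\sqrt T(\widetilde\lambda-\lambda)+o_p(1)\Rightarrow N(0,\Omega_F)$. -/

import Mathlib

open MeasureTheory ProbabilityTheory Filter Topology
open scoped ENNReal

noncomputable section

namespace TwoPass

/-- Column vectors with the Euclidean norm. -/
abbrev Vec (k : ℕ) : Type := EuclideanSpace ℝ (Fin k)

/-- The product `A x` of a matrix and a column vector. -/
def act {m n : Type*} [Fintype m] [Fintype n] (A : Matrix m n ℝ) (x : EuclideanSpace ℝ n) :
    EuclideanSpace ℝ m :=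
  WithLp.toLp 2 (A.mulVec x.ofLp)

/-- The outer product `x y'`. -/
def outer {m n : Type*} [Fintype m] [Fintype n] (x : EuclideanSpace ℝ m)
    (y : EuclideanSpace ℝ n) : Matrix m n ℝ :=
  Matrix.vecMulVec x.ofLp y.ofLp

/-! ### Functions of one sample -/

/-- Time average `T⁻¹ ∑ₜ xₜ`. -/
def timeMean {T : ℕ} {E : Type*} [AddCommGroup E] [Module ℝ E] (x : Fin T → E) : E :=
  (T : ℝ)⁻¹ • ∑ t, x t

/-- Demeaned series `xₜ - T⁻¹ ∑ₛ xₛ`. -/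
def demean {T : ℕ} {E : Type*} [AddCommGroup E] [Module ℝ E] (x : Fin T → E) (t : Fin T) : E :=
  x t - timeMean x

/-- First pass: the slope in the time-series OLS regression of the returns of one asset on a
constant and the factors, `(∑ₜ F̃ₜ F̃ₜ')⁻¹ ∑ₜ F̃ₜ rₜ`. -/
def betaHat {kF T : ℕ} (f : Fin T → Vec kF) (ri : Fin T → ℝ) : Vec kF :=
  act (∑ t, outer (demean f t) (demean f t))⁻¹ (∑ t, ri t • demean f t)

/-- Second pass: OLS regression (without a constant) of the time-averaged returns on the
first-pass estimates, `(∑ᵢ β̂ᵢ β̂ᵢ')⁻¹ ∑ᵢ β̂ᵢ r̄ᵢ`. -/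
def lambdaTP {kF N T : ℕ} (f : Fin T → Vec kF) (r : Fin N → Fin T → ℝ) : Vec kF :=
  act (∑ i, outer (betaHat f (r i)) (betaHat f (r i)))⁻¹
    (∑ i, timeMean (r i) • betaHat f (r i))

/-- `ρ(t,s) = N^{-1/2} ∑ᵢ eᵢₜ eᵢₛ`. -/
def rho {N T : ℕ} (e : Fin N → Fin T → ℝ) (t s : Fin T) : ℝ :=
  (Real.sqrt N)⁻¹ * ∑ i, e i t * e i s

/-- `Sₜ = N⁻¹ ∑ᵢ eᵢₜ²`. -/
def errVar {N T : ℕ} (e : Fin N → Fin T → ℝ) (t : Fin T) : ℝ :=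
  (N : ℝ)⁻¹ * ∑ i, e i t ^ 2

/-- `Wₜ = N^{-1/2} ∑ᵢ γᵢ eᵢₜ`. -/
def wAvg {N T : ℕ} {κ : Type*} [Fintype κ] (γ : Fin N → EuclideanSpace ℝ κ)
    (e : Fin N → Fin T → ℝ) (t : Fin T) : EuclideanSpace ℝ κ :=
  (Real.sqrt N)⁻¹ • ∑ i, e i t • γ i

/-! ### Probabilistic notions -/

/-- Convergence in probability to a constant, each variable living on its own probability
space. -/
def TendstoInProb {ι : Type*} {Ω : ι → Type*} [∀ n, MeasurableSpace (Ω n)]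
    {E : Type*} [PseudoMetricSpace E] (P : ∀ n, Measure (Ω n)) (X : ∀ n, Ω n → E)
    (l : Filter ι) (c : E) : Prop :=
  ∀ ε : ℝ, 0 < ε → Tendsto (fun n => P n {ω | ε ≤ dist (X n ω) c}) l (𝓝 0)

/-- Strict stationarity of a finite stretch `X₁, …, X_T`: any block of consecutive variables has
the law of the initial block of the same length. -/
def IsStationary {Ω E : Type*} [MeasurableSpace Ω] [MeasurableSpace E] {T : ℕ}
    (X : Fin T → Ω → E) (P : Measure Ω) : Prop :=
  ∀ (s m : ℕ) (h : s + m ≤ T),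
    P.map (fun ω (j : Fin m) => X ⟨s + j, by omega⟩ ω)
      = P.map (fun ω (j : Fin m) => X ⟨j, by omega⟩ ω)

/-- Conditional independence of `X₁, …, X_T` given the sigma-algebra `m`, in terms of conditional
probabilities, on an arbitrary probability space (`ProbabilityTheory.iCondIndepFun` needs a
standard Borel space, on which the two notions agree). -/
def IsCondIndep {Ω E : Type*} [MeasurableSpace Ω] [MeasurableSpace E] {T : ℕ}
    (X : Fin T → Ω → E) (P : Measure Ω) (m : MeasurableSpace Ω) : Prop :=
  ∀ A : Fin T → Set E, (∀ t, MeasurableSet (A t)) →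
    P⟦⋂ t, X t ⁻¹' A t | m⟧ =ᵐ[P] fun ω => ∏ t, (P⟦X t ⁻¹' A t | m⟧) ω

/-! ### The factor-pricing model -/

/-- Data-generating processes, one for every pair of sample sizes `(N, T)`, that obey the
correctly specified factor-pricing model
`rᵢₜ = λ'βᵢ + (Fₜ - EFₜ)'βᵢ + vₜ'μᵢ + eᵢₜ`.
The loadings `βᵢ`, `μᵢ` are nonrandom and may change with `(N, T)`, as may the probability space
and the laws of the random variables. -/
structure FactorModel (kF kv : ℕ) where
  /-- sample spaces -/
  Ω : ℕ → ℕ → Type*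
  /-- their sigma-algebras -/
  mΩ : ∀ N T, MeasurableSpace (Ω N T)
  /-- the probability measures -/
  P : ∀ N T, Measure (Ω N T)
  isProb : ∀ N T, IsProbabilityMeasure (P N T)
  /-- observed factors -/
  F : ∀ N T, Fin T → Ω N T → Vec kF
  /-- unobserved (missing) factors -/
  v : ∀ N T, Fin T → Ω N T → Vec kv
  /-- idiosyncratic errors -/
  e : ∀ N T, Fin N → Fin T → Ω N T → ℝ
  /-- excess returns -/
  r : ∀ N T, Fin N → Fin T → Ω N T → ℝ
  /-- risk exposures -/
  β : ∀ N T, Fin N → Vec kF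
  /-- loadings on the missing factors -/
  μ : ∀ N T, Fin N → Vec kv
  /-- risk premia -/
  lam : Vec kF
  measurable_F : ∀ N T t, Measurable (F N T t)
  measurable_v : ∀ N T t, Measurable (v N T t)
  measurable_e : ∀ N T i t, Measurable (e N T i t)
  integrable_F : ∀ N T t, Integrable (F N T t) (P N T)
  return_eq : ∀ N T i t ω, r N T i t ω =
    inner ℝ lam (β N T i) + inner ℝ (F N T t ω - ∫ ω', F N T t ω' ∂(P N T)) (β N T i)
      + inner ℝ (v N T t ω) (μ N T i) + e N T i t ω
  integrable_v : ∀ N T t, Integrable (v N T t) (P N T)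
  mean_v : ∀ N T t, ∫ ω, v N T t ω ∂(P N T) = 0
  uncorr_Fv : ∀ N T t a b, cov[fun ω => F N T t ω a, fun ω => v N T t ω b; P N T] = 0
  integrable_e : ∀ N T i t, Integrable (e N T i t) (P N T)
  mean_e : ∀ N T i t, ∫ ω, e N T i t ω ∂(P N T) = 0
  uncorr_Fe : ∀ N T i t a, cov[fun ω => F N T t ω a, e N T i t; P N T] = 0
  uncorr_ve : ∀ N T i t b, cov[fun ω => v N T t ω b, e N T i t; P N T] = 0

attribute [instance] FactorModel.mΩ FactorModel.isProb

namespace FactorModel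

variable {kF kv : ℕ} (M : FactorModel kF kv)

/-- The sample spaces and measures indexed by the pair `(N, T)`. -/
abbrev space (p : ℕ × ℕ) : Type _ := M.Ω p.1 p.2

/-- The probability measures indexed by the pair `(N, T)`. -/
abbrev prob (p : ℕ × ℕ) : Measure (M.space p) := M.P p.1 p.2

/-- `γᵢ' = (βᵢ', μᵢ')`: all observed factors are strong, so no loading is rescaled by `√T`. -/
def γ (N T : ℕ) (i : Fin N) : EuclideanSpace ℝ (Fin kF ⊕ Fin kv) :=
  WithLp.toLp 2 (Sum.elim (M.β N T i) (M.μ N T i))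

/-- The sigma-algebra generated by `F₁, …, F_T` and `v₁, …, v_T`. -/
@[reducible] def sigmaFv (N T : ℕ) : MeasurableSpace (M.Ω N T) :=
  (⨆ t, MeasurableSpace.comap (M.F N T t) inferInstance) ⊔
    ⨆ t, MeasurableSpace.comap (M.v N T t) inferInstance

/-- Realized observed factors. -/
def Fs (N T : ℕ) (ω : M.Ω N T) : Fin T → Vec kF := fun t => M.F N T t ω

/-- Realized errors. -/
def es (N T : ℕ) (ω : M.Ω N T) : Fin N → Fin T → ℝ := fun i t => M.e N T i t ω

/-- Realized returns. -/
def rs (N T : ℕ) (ω : M.Ω N T) : Fin N → Fin T → ℝ := fun i t => M.r N T i t ω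

/-- Demeaned factor `F̃ₜ = Fₜ - T⁻¹ ∑ₛ Fₛ`. -/
def Ftil (N T : ℕ) (ω : M.Ω N T) (t : Fin T) : Vec kF := demean (M.Fs N T ω) t

/-- The two-pass estimator `λ̂_TP`. -/
def lamTP (N T : ℕ) (ω : M.Ω N T) : Vec kF := lambdaTP (M.Fs N T ω) (M.rs N T ω)

/-- The ex-post risk premia `λ̃ = λ + T⁻¹ ∑ₜ Fₜ - EFₜ`. -/
def lamTilde (N T : ℕ) (ω : M.Ω N T) : Vec kF :=
  M.lam + timeMean (fun t => M.F N T t ω - ∫ ω', M.F N T t ω' ∂(M.P N T))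

/-- `√T (λ̂_TP - λ)`. -/
def scaledTP (p : ℕ × ℕ) (ω : M.space p) : Vec kF :=
  Real.sqrt p.2 • (M.lamTP p.1 p.2 ω - M.lam)

/-- `√T (λ̃ - λ)`. -/
def scaledTilde (p : ℕ × ℕ) (ω : M.space p) : Vec kF :=
  Real.sqrt p.2 • (M.lamTilde p.1 p.2 ω - M.lam)

/-- `T^{-1/2} ∑ₜ (Fₜ - EFₜ)`. -/
def factorSum (N T : ℕ) (ω : M.Ω N T) : Vec kF :=
  (Real.sqrt T)⁻¹ • ∑ t, (M.F N T t ω - ∫ ω', M.F N T t ω' ∂(M.P N T))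

/-- `η_T = T^{-1/2} ∑ₜ Σ_F⁻¹ F̃ₜ vₜ'`. -/
def etaT (SF : Matrix (Fin kF) (Fin kF) ℝ) (N T : ℕ) (ω : M.Ω N T) :
    Matrix (Fin kF) (Fin kv) ℝ :=
  (Real.sqrt T)⁻¹ • ∑ t, SF⁻¹ * outer (M.Ftil N T ω t) (M.v N T t ω)

/-- `η_{v,T} = T^{-1/2} ∑ₜ vₜ`. -/
def etavT (N T : ℕ) (ω : M.Ω N T) : Vec kv :=
  (Real.sqrt T)⁻¹ • ∑ t, M.v N T t ω

/-- Assumption FACTORS. `SF` is the covariance matrix of the observed factors, and `(Z, η, ηv)`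
is the limit of `(T^{-1/2} ∑ₜ (Fₜ - EFₜ), η_T, η_{v,T})`, defined on a probability space
`(Ω', P')`. -/
structure Factors (SF OmF : Matrix (Fin kF) (Fin kF) ℝ)
    (OmvF : Matrix (Fin kv × Fin kF) (Fin kv × Fin kF) ℝ)
    {Ω' : Type*} [MeasurableSpace Ω'] (P' : Measure Ω') [IsProbabilityMeasure P']
    (Z : Ω' → Vec kF) (η : Ω' → Matrix (Fin kF) (Fin kv) ℝ) (ηv : Ω' → Vec kv) : Prop where
  stationary : ∀ N T, IsStationary (M.F N T) (M.P N T)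
  fourth_moment : ∀ N T t, MemLp (M.F N T t) 4 (M.P N T)
  cov_eq : ∀ N T t a b, cov[fun ω => M.F N T t ω a, fun ω => M.F N T t ω b; M.P N T] = SF a b
  full_rank : IsUnit SF.det
  /-- law of large numbers: `T⁻¹ ∑ₜ F̃ₜ F̃ₜ'` is consistent for `Σ_F` -/
  sample_cov : ∀ a b, TendstoInProb M.prob
    (fun p ω => timeMean (fun t => outer (M.Ftil p.1 p.2 ω t) (M.Ftil p.1 p.2 ω t)) a b)
    atTop (SF a b)
  psd_OmF : OmF.PosSemidef
  psd_OmvF : OmvF.PosSemidef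
  law_Z : HasLaw Z (multivariateGaussian 0 OmF) P'
  law_eta : HasLaw (fun ω => (WithLp.toLp 2 (η ω).vec : EuclideanSpace ℝ (Fin kv × Fin kF)))
    (multivariateGaussian 0 OmvF) P'
  law_etav : HasLaw ηv (multivariateGaussian 0 1) P'
  joint : TendstoInDistribution
    (fun (p : ℕ × ℕ) (ω : M.space p) =>
      (M.factorSum p.1 p.2 ω,
        (WithLp.toLp 2 (M.etaT SF p.1 p.2 ω).vec : EuclideanSpace ℝ (Fin kv × Fin kF)),
        M.etavT p.1 p.2 ω))
    atTop
    (fun ω => (Z ω, (WithLp.toLp 2 (η ω).vec : EuclideanSpace ℝ (Fin kv × Fin kF)), ηv ω))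
    M.prob P'

/-- Assumption LOADINGS. -/
structure Loadings (Γ : Matrix (Fin kF ⊕ Fin kv) (Fin kF ⊕ Fin kv) ℝ) : Prop where
  posDef : Γ.PosDef
  tendsto : Tendsto
    (fun p : ℕ × ℕ => (p.1 : ℝ)⁻¹ • ∑ i, outer (M.γ p.1 p.2 i) (M.γ p.1 p.2 i)) atTop (𝓝 Γ)
  fourth_moment : ∃ C : ℝ, ∀ N T : ℕ, 0 < N → 0 < T → (N : ℝ)⁻¹ * ∑ i, ‖M.γ N T i‖ ^ 4 ≤ C

/-- Assumption ERRORS. The moment bounds are uniform in `N`, `T` and the time indices. -/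
structure Errors : Prop where
  cond_indep : ∀ N T, IsCondIndep (fun t ω i => M.e N T i t ω) (M.P N T) (M.sigmaFv N T)
  cond_mean : ∀ N T i t, (M.P N T)[M.e N T i t | M.sigmaFv N T] =ᵐ[M.P N T] 0
  rho_moment : ∃ C : ℝ, ∀ (N T : ℕ) (t s : Fin T), s ≠ t →
    ∫⁻ ω, ENNReal.ofReal ((1 + ‖M.F N T t ω‖ ^ 4) * (rho (M.es N T ω) s t ^ 2 + 1)) ∂(M.P N T)
      ≤ ENNReal.ofReal C
  errVar_mean : TendstoInProb M.prob
    (fun p ω => (Real.sqrt p.1 / p.2) • ∑ t, errVar (M.es p.1 p.2 ω) t • M.Ftil p.1 p.2 ω t)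
    atTop 0
  errVar_sq : ∃ SSF : Matrix (Fin kF) (Fin kF) ℝ, ∀ a b, TendstoInProb M.prob
    (fun p ω => timeMean (fun t =>
      errVar (M.es p.1 p.2 ω) t • outer (M.Ftil p.1 p.2 ω t) (M.Ftil p.1 p.2 ω t)) a b)
    atTop (SSF a b)
  wAvg_moment : ∃ C : ℝ, ∀ (N T : ℕ) (t : Fin T),
    ∫⁻ ω, ENNReal.ofReal ((1 + ‖M.F N T t ω‖ ^ 2) * ‖wAvg (M.γ N T) (M.es N T ω) t‖ ^ 2)
      ∂(M.P N T) ≤ ENNReal.ofReal C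

end FactorModel

/-- `Γ_ββ⁻¹ Γ_βμ (ηv - η' λ)`. -/
def ovLimit {kF kv : ℕ} (Γ : Matrix (Fin kF ⊕ Fin kv) (Fin kF ⊕ Fin kv) ℝ) (lam : Vec kF)
    (η : Matrix (Fin kF) (Fin kv) ℝ) (ηv : Vec kv) : Vec kF :=
  act (Γ.toBlocks₁₁⁻¹ * Γ.toBlocks₁₂) (ηv - act η.transpose lam)

end TwoPass

end

/-! Write G for the matrix of loadings, D for the demeaned factors, V for the missing factors, E for
the errors, S = D'D/T, Q = ED/T, and ē for the time averages of the errors. Stationarity turns λ +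
F_t - EF_t into λ̃ + F̃_t. The first pass therefore returns B = GJ + QS⁻¹, where J stacks the
identity on T^{-1/2} η_T' Σ_F S⁻¹: a missing factor biases each β̂_i by a multiple of μ_i of order
T^{-1/2}. The mean returns are r̄ = Bλ̃ + G(0; v̄ - T^{-1/2} η_T' Σ_F S⁻¹ λ̃) + (ē - QS⁻¹λ̃). The
second pass reproduces λ̃ exactly from the term Bλ̃. So √T(λ̂_TP - λ̃) is (B'B/N)⁻¹ times (B'G/N)(0;
η_{v,T} - η_T' Σ_F S⁻¹ λ̃), plus terms in the errors. Since J tends to (I; 0), B'B/N tends to Γ_ββ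
and B'G/N to (Γ_ββ, Γ_βμ), and the first term gives Γ_ββ⁻¹Γ_βμ(η_v - η'λ). The exact identity is
`twoPass_expansion`, and its limit is `tendsto_scaledError`.

The errors enter only through G'ē, G'Q, Q'Q and Q'ē, each divided by N, and √T times each must
vanish with no restriction on N/T. The tool is orthogonality over time: given all factors and the
errors of all other dates, e_t has mean zero (`IsCondIndep.condExp_sigmaOthers`). The averages
linear in the errors are sums over t of orthogonal terms built from W_t, with second moment O(1/N).
In the quadratic averages the pairs of different dates give orthogonal terms ρ(t,s) times
regressors; there are at most T² of them, and their contribution has second moment O(1/(NT)). Equal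
dates leave sums of F̃_t S_t or F̃_t F̃_t' S_t, which ERRORS (iii) controls.

Orthogonality needs regressors with moment bounds, so it is proved for the constant and the raw
factors. Demeaned factors follow by bilinearity, because the time mean of the factors is bounded in
probability.

Every sample size has its own probability space. Convergence in probability to a constant is
convergence along the filter `inProb`, so that limits are combined by ordinary continuity, and
boundedness in probability is a multiplier property along that filter. -/

namespace TwoPass

/-! ### The filter of events whose probability tends to one -/

section StochasticOrder

variable {ι : Type*} {Ω : ι → Type*} [∀ n, MeasurableSpace (Ω n)] {P : ∀ n, Measure (Ω n)}
  {l : Filter ι}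

/-- The filter on the disjoint union of the sample spaces that consists of the events whose
complements have probability tending to zero. Convergence in probability to a constant is
convergence along this filter. -/
def inProb (P : ∀ n, Measure (Ω n)) (l : Filter ι) : Filter (Σ n, Ω n) where
  sets := {S | Tendsto (fun n => P n {ω | (⟨n, ω⟩ : Σ n, Ω n) ∉ S}) l (𝓝 0)}
  univ_sets := by simpa using tendsto_const_nhds
  sets_of_superset := by
    intro S S' hS hSS'
    refine tendsto_of_tendsto_of_tendsto_of_le_of_le tendsto_const_nhds hS
      (fun _ => zero_le) (fun n => measure_mono fun ω hω h => hω (hSS' h))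
  inter_sets := by
    intro S S' hS hS'
    refine tendsto_of_tendsto_of_tendsto_of_le_of_le tendsto_const_nhds
      (by simpa using Tendsto.add hS hS') (fun _ => zero_le) (fun n => ?_)
    refine (measure_mono fun ω hω => ?_).trans (measure_union_le _ _)
    by_contra h
    simp only [Set.mem_union, Set.mem_ofPred_eq, not_or, not_not] at h
    exact hω ⟨h.1, h.2⟩

theorem mem_inProb {S : Set (Σ n, Ω n)} :
    S ∈ inProb P l ↔ Tendsto (fun n => P n {ω | (⟨n, ω⟩ : Σ n, Ω n) ∉ S}) l (𝓝 0) := Iff.rfl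

theorem tendstoInProb_iff {E : Type*} [PseudoMetricSpace E] {X : ∀ n, Ω n → E} {c : E} :
    TendstoInProb P X l c ↔
      Tendsto (fun x : Σ n, Ω n => X x.1 x.2) (inProb P l) (𝓝 c) := by
  rw [Metric.tendsto_nhds]
  refine forall₂_congr fun ε _ => ?_
  rw [Filter.Eventually, mem_inProb]
  simp

theorem tendsto_fst_inProb : Tendsto (fun x : Σ n, Ω n => x.1) (inProb P l) l := by
  intro S hS
  rw [mem_map, mem_inProb]
  refine tendsto_const_nhds.congr' ?_
  filter_upwards [hS] with n hn
  simp [hn]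

/-- Markov's inequality, as a criterion for convergence in probability. -/
theorem tendsto_inProb_of_lintegral {X : ∀ n, Ω n → ℝ} (hX : ∀ n, Measurable (X n)) {a : ι → ℝ}
    (ha : Tendsto a l (𝓝 0)) (h : ∀ᶠ n in l, ∫⁻ ω, ‖X n ω‖ₑ ∂(P n) ≤ ENNReal.ofReal (a n)) :
    Tendsto (fun x : Σ n, Ω n => X x.1 x.2) (inProb P l) (𝓝 0) := by
  rw [← tendstoInProb_iff]
  intro ε hε
  have hε' : ENNReal.ofReal ε ≠ 0 := by simpa using hε
  have h0 : Tendsto (fun n => ENNReal.ofReal (a n) / ENNReal.ofReal ε) l (𝓝 0) := by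
    have := ENNReal.Tendsto.div_const (b := ENNReal.ofReal ε)
      ((ENNReal.continuous_ofReal.tendsto 0).comp ha) (Or.inr hε')
    simpa using this
  refine tendsto_of_tendsto_of_tendsto_of_le_of_le' tendsto_const_nhds h0
    (Eventually.of_forall fun _ => zero_le) ?_
  filter_upwards [h] with n hn
  have hset : {ω | ε ≤ dist (X n ω) 0} = {ω | ENNReal.ofReal ε ≤ ‖X n ω‖ₑ} := by
    ext ω
    simp only [Set.mem_ofPred_eq, dist_zero_right, ← ofReal_norm]
    rw [ENNReal.ofReal_le_ofReal_iff (norm_nonneg _)]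
  rw [hset]
  refine (meas_ge_le_lintegral_div (hX n).enorm.aemeasurable hε' ENNReal.ofReal_ne_top).trans ?_
  gcongr

/-- A real function is bounded along a filter in the weak sense that its product with every null
function is a null function. Along `inProb P l` this is boundedness in probability. -/
def StochBounded {α : Type*} (L : Filter α) (X : α → ℝ) : Prop :=
  ∀ Y : α → ℝ, Tendsto Y L (𝓝 0) → Tendsto (fun x => X x * Y x) L (𝓝 0)

theorem StochBounded.of_tendsto {α : Type*} {L : Filter α} {X : α → ℝ} {c : ℝ}
    (h : Tendsto X L (𝓝 c)) : StochBounded L X := fun Y hY => by simpa using h.mul hY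

/-- Tightness gives the multiplier form: where |X| < K, the product XY can exceed δ only if |Y|
exceeds δ/(|K|+1). -/
theorem StochBounded.of_tail {X : ∀ n, Ω n → ℝ}
    (h : ∀ ε : ℝ≥0∞, 0 < ε → ∃ K : ℝ, ∀ᶠ n in l, P n {ω | K ≤ |X n ω|} ≤ ε) :
    StochBounded (inProb P l) (fun x => X x.1 x.2) := by
  intro Y hY
  rw [Metric.tendsto_nhds] at hY ⊢
  intro δ hδ
  rw [Filter.Eventually, mem_inProb, ENNReal.tendsto_nhds_zero]
  intro ε hε
  obtain ⟨K, hK⟩ := h (ε / 2) (ENNReal.half_pos hε.ne')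
  have hδ' : 0 < δ / (|K| + 1) := by positivity
  have h2 := hY _ hδ'
  rw [Filter.Eventually, mem_inProb, ENNReal.tendsto_nhds_zero] at h2
  filter_upwards [hK, h2 (ε / 2) (ENNReal.half_pos hε.ne')] with n h1 h2
  rw [← ENNReal.add_halves ε]
  refine (measure_mono ?_).trans ((measure_union_le _ _).trans (add_le_add h1 h2))
  intro ω hω
  by_contra hc
  simp only [Set.mem_union, Set.mem_ofPred_eq, not_or, not_not, not_le, dist_zero_right,
    Real.norm_eq_abs, abs_mul] at hc hω
  obtain ⟨hc1, hc2⟩ := hc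
  apply hω
  have hXK : |X n ω| ≤ |K| + 1 := by linarith [le_abs_self K]
  calc |X n ω| * |Y ⟨n, ω⟩| ≤ (|K| + 1) * |Y ⟨n, ω⟩| := by gcongr
    _ < (|K| + 1) * (δ / (|K| + 1)) := by gcongr
    _ = δ := by field_simp

theorem StochBounded.of_lintegral {X : ∀ n, Ω n → ℝ} (hX : ∀ n, Measurable (X n)) {C : ℝ}
    (h : ∀ᶠ n in l, ∫⁻ ω, ‖X n ω‖ₑ ∂(P n) ≤ ENNReal.ofReal C) :
    StochBounded (inProb P l) (fun x => X x.1 x.2) := by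
  refine StochBounded.of_tail fun ε hε => ?_
  have h0 : Tendsto (fun K : ℝ => ENNReal.ofReal C / ENNReal.ofReal K) atTop (𝓝 0) := by
    have := ENNReal.Tendsto.const_div (a := ENNReal.ofReal C)
      ENNReal.tendsto_ofReal_atTop (Or.inr ENNReal.ofReal_ne_top)
    simpa using this
  obtain ⟨K, hK, hKpos⟩ := ((ENNReal.tendsto_nhds_zero.1 h0 ε hε).and
    (eventually_gt_atTop 0)).exists
  refine ⟨K, ?_⟩
  filter_upwards [h] with n hn
  have hset : {ω | K ≤ |X n ω|} = {ω | ENNReal.ofReal K ≤ ‖X n ω‖ₑ} := by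
    ext ω
    simp only [Set.mem_ofPred_eq, ← ofReal_norm]
    rw [ENNReal.ofReal_le_ofReal_iff (norm_nonneg _), Real.norm_eq_abs]
  rw [hset]
  refine ((meas_ge_le_lintegral_div (hX n).enorm.aemeasurable (by simpa using hKpos)
    ENNReal.ofReal_ne_top).trans ?_).trans hK
  gcongr

variable [∀ n, IsProbabilityMeasure (P n)]

/-- A sequence that converges in distribution is bounded in probability. -/
theorem StochBounded.of_tendstoInDistribution {X : ∀ n, Ω n → ℝ} {Ω' : Type*} [MeasurableSpace Ω']
    {P' : Measure Ω'} [IsProbabilityMeasure P'] {Z : Ω' → ℝ}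
    (h : TendstoInDistribution X l Z P P') :
    StochBounded (inProb P l) (fun x => X x.1 x.2) := by
  refine StochBounded.of_tail fun ε hε => ?_
  have hZ := h.aemeasurable_limit
  have hcl : ∀ K : ℝ, IsClosed {x : ℝ | K ≤ |x|} := fun K =>
    isClosed_le continuous_const continuous_abs
  have htail : Tendsto (fun k : ℕ => (P'.map Z) {x : ℝ | (k : ℝ) ≤ |x|}) atTop (𝓝 0) := by
    have hinter : (⋂ k : ℕ, {x : ℝ | (k : ℝ) ≤ |x|}) = ∅ := by
      ext x
      obtain ⟨k, hk⟩ := exists_nat_gt |x|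
      simp only [Set.mem_iInter, Set.mem_ofPred_eq, Set.mem_empty_iff_false, iff_false, not_forall,
        not_le]
      exact ⟨k, hk⟩
    have := Measure.isProbabilityMeasure_map hZ
    rw [← measure_empty (μ := P'.map Z), ← hinter]
    refine tendsto_measure_iInter_atTop (fun k => (hcl k).measurableSet.nullMeasurableSet) ?_
      ⟨0, measure_ne_top _ _⟩
    intro i j hij x hx
    have hij' : (i : ℝ) ≤ j := by exact_mod_cast hij
    exact hij'.trans hx
  obtain ⟨k, hk⟩ := (htail.eventually_lt_const hε).exists
  refine ⟨k, ?_⟩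
  -- The portmanteau theorem for the closed tail {|x| ≥ k} transfers the smallness of the tail of
  -- the limit to all late n.
  have hlim := ProbabilityMeasure.limsup_measure_closed_le_of_tendsto h.tendsto (hcl k)
  have := eventually_lt_of_limsup_lt (hlim.trans_lt hk)
  filter_upwards [this] with n hn
  rw [ProbabilityMeasure.coe_mk, Measure.map_apply_of_aemeasurable (h.forall_aemeasurable n)
    (hcl k).measurableSet] at hn
  exact hn.le

/-- If `X n` converges in distribution to `Z` and `Y n - X n` converges in probability to zero,
then `Y n` converges in distribution to `Z`; here every `n` has its own sample space. -/
theorem tendstoInDistribution_of_sub {E : Type*} [NormedAddCommGroup E] [MeasurableSpace E]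
    [BorelSpace E] [SecondCountableTopology E] [l.IsCountablyGenerated] {X Y : ∀ n, Ω n → E}
    {Ω' : Type*} [MeasurableSpace Ω'] {P' : Measure Ω'} [IsProbabilityMeasure P'] {Z : Ω' → E}
    (h : TendstoInDistribution X l Z P P') (hY : ∀ n, AEMeasurable (Y n) (P n))
    (hXY : TendstoInProb P (fun n ω => Y n ω - X n ω) l 0) :
    TendstoInDistribution Y l Z P P' := by
  have hX := h.forall_aemeasurable
  -- Only the joint law of `(X n, Y n)` matters. The product of these laws realizes all pairs on one
  -- space, where Slutsky's lemma for a single space applies.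
  let ν : ι → Measure (E × E) := fun n => (P n).map (fun ω => (X n ω, Y n ω))
  have hν : ∀ n, IsProbabilityMeasure (ν n) := fun n =>
    Measure.isProbabilityMeasure_map ((hX n).prodMk (hY n))
  have hcoord : ∀ n, (Measure.infinitePi ν).map (fun ω : ι → E × E => ω n) = ν n := fun n =>
    (measurePreserving_eval_infinitePi ν n).map_eq
  have hmap1 : ∀ n, (Measure.infinitePi ν).map (fun ω => (ω n).1) = (P n).map (X n) := fun n => by
    have : (fun ω : ι → E × E => (ω n).1) = Prod.fst ∘ fun ω => ω n := rfl
    rw [this, ← Measure.map_map measurable_fst (measurable_pi_apply n), hcoord,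
      AEMeasurable.map_map_of_aemeasurable measurable_fst.aemeasurable ((hX n).prodMk (hY n))]
    rfl
  have hmap2 : ∀ n, (Measure.infinitePi ν).map (fun ω => (ω n).2) = (P n).map (Y n) := fun n => by
    have : (fun ω : ι → E × E => (ω n).2) = Prod.snd ∘ fun ω => ω n := rfl
    rw [this, ← Measure.map_map measurable_snd (measurable_pi_apply n), hcoord,
      AEMeasurable.map_map_of_aemeasurable measurable_snd.aemeasurable ((hX n).prodMk (hY n))]
    rfl
  have hX' : TendstoInDistribution (fun n (ω : ι → E × E) => (ω n).1) l Z
      (fun _ => Measure.infinitePi ν) P' := by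
    refine ⟨fun n => (measurable_fst.comp (measurable_pi_apply n)).aemeasurable,
      h.aemeasurable_limit, ?_⟩
    have := h.tendsto
    simp_rw [hmap1]
    exact this
  have hY' : TendstoInDistribution (fun n (ω : ι → E × E) => (ω n).2) l Z
      (fun _ => Measure.infinitePi ν) P' := by
    refine tendstoInDistribution_of_tendstoInMeasure_sub _ _ hX' ?_
      fun n => (measurable_snd.comp (measurable_pi_apply n)).aemeasurable
    rw [tendstoInMeasure_iff_norm]
    intro ε hε
    refine (hXY ε hε).congr fun n => ?_
    have hS : MeasurableSet {x : E × E | ε ≤ ‖x.2 - x.1‖} :=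
      measurableSet_le measurable_const (by fun_prop)
    have e1 := Measure.map_apply_of_aemeasurable ((hX n).prodMk (hY n)) hS
    have e2 : (Measure.infinitePi ν).map (fun ω : ι → E × E => ω n) {x | ε ≤ ‖x.2 - x.1‖} = _ :=
      Measure.map_apply (measurable_pi_apply n) hS
    rw [hcoord] at e2
    simp only [dist_zero_right, Pi.zero_apply, sub_zero, Pi.sub_apply]
    exact e1.symm.trans e2
  refine ⟨hY, h.aemeasurable_limit, ?_⟩
  have := hY'.tendsto
  simp_rw [hmap2] at this
  exact this

end StochasticOrder

/-! ### Conditional independence and orthogonality -/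

section CondIndep

variable {Ω : Type*} {m G m₀ : MeasurableSpace Ω} {P : Measure Ω} [IsProbabilityMeasure P]

theorem integral_mul_eq_zero_of_condExp_eq_zero (hG : G ≤ m₀)
    {X Y : Ω → ℝ} (hX : Measurable[G] X) (hXY : Integrable (X * Y) P) (hY : Integrable Y P)
    (h : P[Y | G] =ᵐ[P] 0) : ∫ ω, X ω * Y ω ∂P = 0 := by
  have h1 := condExp_mul_of_stronglyMeasurable_left (m := G) hX.stronglyMeasurable hXY hY
  calc ∫ ω, X ω * Y ω ∂P = ∫ ω, (P[X * Y | G]) ω ∂P := (integral_condExp hG).symm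
    _ = ∫ ω, (0 : ℝ) ∂P := by
      refine integral_congr_ae ?_
      filter_upwards [h1, h] with ω h1 h2
      simp [h1, h2]
    _ = 0 := by simp

theorem condExp_eq_zero_of_setIntegral (hG : G ≤ m₀) {Y : Ω → ℝ}
    (hY : Integrable Y P) (h : ∀ s, MeasurableSet[G] s → ∫ ω in s, Y ω ∂P = 0) :
    P[Y | G] =ᵐ[P] 0 := by
  refine (ae_eq_condExp_of_forall_setIntegral_eq hG hY (g := fun _ => 0) ?_ ?_ ?_).symm
  · intro s _ _
    exact integrableOn_zero
  · intro s hs _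
    simp [h s hs]
  · exact aestronglyMeasurable_const

variable {E : Type*} [MeasurableSpace E] {T : ℕ} {X : Fin T → Ω → E}

/-- The definition is applied twice, with the whole space and with `C` in slot `t`. The two products
differ only in that slot, whose factor is 1 in the first case. -/
theorem IsCondIndep.condProb_inter (hind : IsCondIndep X P m) (hm : m ≤ m₀) {t : Fin T}
    {B : Fin T → Set E}
    (hB : ∀ s, MeasurableSet (B s)) (hBt : B t = Set.univ) {C : Set E} (hC : MeasurableSet C) :
    P⟦X t ⁻¹' C ∩ ⋂ s, X s ⁻¹' B s | m⟧ =ᵐ[P]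
      fun ω => (P⟦⋂ s, X s ⁻¹' B s | m⟧) ω * (P⟦X t ⁻¹' C | m⟧) ω := by
  have h1 := hind B hB
  have h2 := hind (Function.update B t C) fun s => by
    by_cases h : s = t
    · subst h; simpa using hC
    · simpa [h] using hB s
  have hset : (⋂ s, X s ⁻¹' Function.update B t C s) = X t ⁻¹' C ∩ ⋂ s, X s ⁻¹' B s := by
    ext ω
    simp only [Set.mem_iInter, Set.mem_preimage, Set.mem_inter_iff]
    constructor
    · refine fun h => ⟨by simpa using h t, fun s => ?_⟩
      by_cases hs : s = t
      · subst hs; simp [hBt]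
      · simpa [hs] using h s
    · rintro ⟨h, h'⟩ s
      by_cases hs : s = t
      · subst hs; simpa using h
      · simpa [hs] using h' s
  rw [hset] at h2
  filter_upwards [h1, h2] with ω h1 h2
  rw [h1, h2, ← Finset.mul_prod_erase _ _ (Finset.mem_univ t),
    ← Finset.mul_prod_erase _ _ (Finset.mem_univ t), hBt, Function.update_self, Set.preimage_univ,
    Set.indicator_univ, condExp_const hm, one_mul, mul_comm]
  congr 1
  refine Finset.prod_congr rfl fun s hs => ?_
  rw [Function.update_of_ne (Finset.ne_of_mem_erase hs)]

/-- Split 1_D into q = P(D | m) and 1_D - q. The part with q vanishes because 1_A q is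
`m`-measurable and g(X_t) has conditional mean zero given `m`. For the rest, conditional
independence makes 1_A(1_D - q) orthogonal to every event of X_t, hence to g(X_t). -/
theorem IsCondIndep.setIntegral_eq_zero (hind : IsCondIndep X P m) (hm : m ≤ m₀)
    (hX : ∀ s, Measurable (X s)) {t : Fin T} {g : E → ℝ} (hg : Measurable g)
    (hY : Integrable (fun ω => g (X t ω)) P) (h0 : P[fun ω => g (X t ω) | m] =ᵐ[P] 0)
    {A : Set Ω} (hA : MeasurableSet[m] A) {B : Fin T → Set E} (hB : ∀ s, MeasurableSet (B s))
    (hBt : B t = Set.univ) :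
    ∫ ω in A ∩ ⋂ s, X s ⁻¹' B s, g (X t ω) ∂P = 0 := by
  set D : Set Ω := ⋂ s, X s ⁻¹' B s with hD
  set q : Ω → ℝ := P⟦D | m⟧ with hq
  have hDm : MeasurableSet D := MeasurableSet.iInter fun s => hX s (hB s)
  have hAm : MeasurableSet A := hm _ hA
  have hqm : Measurable[m] q := stronglyMeasurable_condExp.measurable
  have hqm' : Measurable q := hqm.mono hm le_rfl
  have hDi : Integrable (D.indicator fun _ => (1 : ℝ)) P :=
    (integrable_const (1 : ℝ)).indicator hDm
  have hqb : ∀ᵐ ω ∂P, ‖q ω‖ ≤ 1 := by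
    have h1 : 0 ≤ᵐ[P] q := condExp_nonneg (ae_of_all _ fun ω => Set.indicator_nonneg (by simp) ω)
    have h2 : q ≤ᵐ[P] P[fun _ => (1 : ℝ) | m] := condExp_mono hDi (integrable_const 1)
      (ae_of_all _ fun ω => Set.indicator_le_self' (by simp) ω)
    rw [condExp_const hm] at h2
    filter_upwards [h1, h2] with ω h1 h2
    rw [Real.norm_eq_abs, abs_of_nonneg h1]
    exact h2
  have hqi : Integrable q P := integrable_condExp
  -- the product with `q` integrates to zero over `A`
  have hqY : ∫ ω in A, q ω * g (X t ω) ∂P = 0 := by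
    have hi : Integrable (A.indicator q * fun ω => g (X t ω)) P := by
      refine hY.bdd_mul (c := 1) ((hqm'.indicator hAm).aestronglyMeasurable) ?_
      filter_upwards [hqb] with ω h
      exact (norm_indicator_le_norm_self q ω).trans h
    have := integral_mul_eq_zero_of_condExp_eq_zero hm (hqm.indicator hA) hi hY h0
    rw [← integral_indicator hAm, ← this]
    refine integral_congr_ae (ae_of_all _ fun ω => ?_)
    by_cases hω : ω ∈ A <;> simp [hω]
  -- `1_A (1_D - q)` has conditional mean zero given `X t`
  set h : Ω → ℝ := A.indicator (fun ω => D.indicator (fun _ => (1 : ℝ)) ω - q ω) with hh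
  have hhi : Integrable h P := (hDi.sub hqi).indicator hAm
  have hcomap : MeasurableSpace.comap (X t) inferInstance ≤ m₀ := (hX t).comap_le
  have hcond : P[h | MeasurableSpace.comap (X t) inferInstance] =ᵐ[P] 0 := by
    refine condExp_eq_zero_of_setIntegral hcomap hhi ?_
    rintro _ ⟨C, hC, rfl⟩
    have hCm : MeasurableSet (X t ⁻¹' C) := hX t hC
    have hCi : Integrable ((X t ⁻¹' C).indicator fun _ => (1 : ℝ)) P :=
      (integrable_const (1 : ℝ)).indicator hCm
    have hCDi : Integrable ((X t ⁻¹' C ∩ D).indicator fun _ => (1 : ℝ)) P :=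
      (integrable_const (1 : ℝ)).indicator (hCm.inter hDm)
    have hqC : Integrable (q * (X t ⁻¹' C).indicator fun _ => (1 : ℝ)) P :=
      hCi.bdd_mul hqm'.aestronglyMeasurable hqb
    have e1 : ∫ ω in A, (X t ⁻¹' C ∩ D).indicator (fun _ => (1 : ℝ)) ω ∂P
        = ∫ ω in A, q ω * (P⟦X t ⁻¹' C | m⟧) ω ∂P := by
      rw [← setIntegral_condExp hm hCDi hA]
      exact setIntegral_congr_ae hAm ((hind.condProb_inter hm hB hBt hC).mono fun ω h _ => h)
    have e2 : ∫ ω in A, (q * (X t ⁻¹' C).indicator fun _ => (1 : ℝ)) ω ∂P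
        = ∫ ω in A, q ω * (P⟦X t ⁻¹' C | m⟧) ω ∂P := by
      rw [← setIntegral_condExp hm hqC hA]
      refine setIntegral_congr_ae hAm ?_
      filter_upwards [condExp_mul_of_stronglyMeasurable_left hqm.stronglyMeasurable hqC hCi]
        with ω h _ using h
    have e3 : ∫ ω in X t ⁻¹' C, h ω ∂P
        = ∫ ω in A, ((X t ⁻¹' C ∩ D).indicator (fun _ => (1 : ℝ)) ω
          - (q * (X t ⁻¹' C).indicator fun _ => (1 : ℝ)) ω) ∂P := by
      rw [← integral_indicator hCm, ← integral_indicator hAm]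
      refine integral_congr_ae (ae_of_all _ fun ω => ?_)
      by_cases h1 : ω ∈ A <;> by_cases h2 : X t ω ∈ C <;> by_cases h3 : ω ∈ D <;>
        simp [hh, h1, h2, h3, Set.indicator]
    rw [e3, integral_sub hCDi.integrableOn hqC.integrableOn, e1, e2, sub_self]
  have hhb : ∀ᵐ ω ∂P, ‖h ω‖ ≤ 2 := by
    filter_upwards [hqb] with ω hω
    refine (norm_indicator_le_norm_self _ ω).trans ((norm_sub_le _ _).trans ?_)
    have : ‖D.indicator (fun _ => (1 : ℝ)) ω‖ ≤ 1 :=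
      (norm_indicator_le_norm_self _ ω).trans (by simp)
    linarith
  have hgX : Measurable[MeasurableSpace.comap (X t) inferInstance] fun ω => g (X t ω) :=
    hg.comp (comap_measurable (X t))
  have hYh : ∫ ω, g (X t ω) * h ω ∂P = 0 := by
    refine integral_mul_eq_zero_of_condExp_eq_zero hcomap hgX ?_ hhi hcond
    exact hY.mul_bdd hhi.aestronglyMeasurable hhb
  have hDY : ∫ ω in A, D.indicator (fun ω => g (X t ω)) ω ∂P = 0 := by
    have hqYi : Integrable (fun ω => q ω * g (X t ω)) P :=
      hY.bdd_mul hqm'.aestronglyMeasurable hqb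
    have : ∫ ω, g (X t ω) * h ω ∂P
        = ∫ ω in A, (D.indicator (fun ω => g (X t ω)) ω - q ω * g (X t ω)) ∂P := by
      rw [← integral_indicator hAm]
      refine integral_congr_ae (ae_of_all _ fun ω => ?_)
      by_cases h1 : ω ∈ A <;> by_cases h3 : ω ∈ D <;> simp [hh, h1, h3] <;> ring
    rw [integral_sub (hY.indicator hDm).integrableOn hqYi.integrableOn, hqY, sub_zero] at this
    rw [← this, hYh]
  rw [← hDY, setIntegral_indicator hDm]

/-- The sigma-algebra generated by `m` and all `X s` with `s ≠ t`. -/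
@[reducible] def sigmaOthers (X : Fin T → Ω → E) (m : MeasurableSpace Ω) (t : Fin T) :
    MeasurableSpace Ω :=
  ⨆ i ∈ ({some t}ᶜ : Set (Option (Fin T))),
    i.elim m fun s => MeasurableSpace.comap (X s) inferInstance

theorem le_sigmaOthers (t : Fin T) : m ≤ sigmaOthers X m t :=
  le_iSup₂_of_le (f := fun (i : Option (Fin T)) (_ : i ∈ ({some t}ᶜ : Set (Option (Fin T)))) =>
    i.elim m fun s => MeasurableSpace.comap (X s) inferInstance) none (by simp) le_rfl

theorem comap_le_sigmaOthers {s t : Fin T} (h : s ≠ t) :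
    MeasurableSpace.comap (X s) inferInstance ≤ sigmaOthers X m t :=
  le_iSup₂_of_le (f := fun (i : Option (Fin T)) (_ : i ∈ ({some t}ᶜ : Set (Option (Fin T)))) =>
    i.elim m fun s => MeasurableSpace.comap (X s) inferInstance) (some s) (by simpa using h) le_rfl

theorem sigmaOthers_le (hm : m ≤ m₀) (hX : ∀ s, Measurable (X s)) (t : Fin T) :
    sigmaOthers X m t ≤ m₀ := by
  refine iSup₂_le fun i _ => ?_
  cases i with
  | none => exact hm
  | some s => exact (hX s).comap_le

/-- Under conditional independence given `m`, a function of `X t` with conditional mean zero given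
`m` also has conditional mean zero given `m` and the other variables. -/
theorem IsCondIndep.condExp_sigmaOthers (hind : IsCondIndep X P m) (hm : m ≤ m₀)
    (hX : ∀ s, Measurable (X s)) {t : Fin T} {g : E → ℝ} (hg : Measurable g)
    (hY : Integrable (fun ω => g (X t ω)) P) (h0 : P[fun ω => g (X t ω) | m] =ᵐ[P] 0) :
    P[fun ω => g (X t ω) | sigmaOthers X m t] =ᵐ[P] 0 := by
  have hG := sigmaOthers_le hm hX t
  refine condExp_eq_zero_of_setIntegral hG hY ?_
  have hY0 : ∫ ω, g (X t ω) ∂P = 0 := by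
    have := hind.setIntegral_eq_zero hm hX hg hY h0 (A := Set.univ) MeasurableSet.univ
      (B := fun _ => Set.univ) (fun _ => MeasurableSet.univ) rfl
    simpa using this
  have hpi : ∀ i : Option (Fin T), IsPiSystem {s | MeasurableSet[i.elim m fun s =>
      MeasurableSpace.comap (X s) inferInstance] s} := fun i =>
    @MeasurableSpace.isPiSystem_measurableSet _
      (i.elim m fun s => MeasurableSpace.comap (X s) inferInstance)
  -- π-λ argument. The generators are intersections of an event of `m` with events of the other
  -- dates; on them the integral vanishes by `setIntegral_eq_zero`, slot `t` being filled with the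
  -- whole space.
  refine MeasurableSpace.induction_on_inter
    (C := fun s _ => ∫ ω in s, g (X t ω) ∂P = 0)
    (generateFrom_piiUnionInter_measurableSet (fun i : Option (Fin T) =>
      i.elim m fun s => MeasurableSpace.comap (X s) inferInstance) _).symm
    (isPiSystem_piiUnionInter _ hpi _) ?_ ?_ ?_ ?_
  · simp
  · rintro _ ⟨p, hp, f, hf, rfl⟩
    have hB : ∀ s : Fin T, ∃ B : Set E, MeasurableSet B ∧ (s = t → B = Set.univ) ∧
        X s ⁻¹' B = if some s ∈ p then f (some s) else Set.univ := by
      intro s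
      by_cases hs : some s ∈ p
      · obtain ⟨B, hB, hBf⟩ := hf _ hs
        refine ⟨B, hB, fun h => ?_, by simp [hs, hBf]⟩
        subst h
        exact absurd (hp hs) (by simp)
      · exact ⟨Set.univ, MeasurableSet.univ, fun _ => rfl, by simp [hs]⟩
    choose B hBm hBt hBf using hB
    have hA : MeasurableSet[m] (if none ∈ p then f none else Set.univ) := by
      split_ifs with h
      · exact hf _ h
      · exact MeasurableSet.univ
    have := hind.setIntegral_eq_zero hm hX hg hY h0 hA hBm (hBt t rfl)
    convert! this using 3
    ext ω
    simp only [Set.mem_iInter, Set.mem_inter_iff]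
    constructor
    · intro h
      refine ⟨?_, fun s => ?_⟩
      · split_ifs with hn
        · exact h _ hn
        · trivial
      · rw [hBf]
        split_ifs with hn
        · exact h _ hn
        · trivial
    · rintro ⟨h1, h2⟩ i hi
      cases i with
      | none => simpa [hi] using h1
      | some s =>
        have := h2 s
        rw [hBf] at this
        simpa [hi] using this
  · intro s hs h
    have := setIntegral_compl (hG _ hs) hY
    rw [this, hY0, h, sub_zero]
  · intro f hf hfm h
    rw [integral_iUnion (fun i => hG _ (hfm i)) hf hY.integrableOn]
    simp [h]

/-- A sum `∑ᵢ Xᵢ Yᵢ` that is integrable has mean zero if every `Yᵢ` has conditional mean zero given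
a sigma-algebra for which all `Xᵢ` are measurable; the summands need not be integrable. -/
theorem integral_sum_mul_eq_zero {κ : Type*} [Fintype κ] (hG : G ≤ m₀)
    {U Y : κ → Ω → ℝ} (hU : ∀ i, Measurable[G] (U i)) (hY : ∀ i, Integrable (Y i) P)
    (h0 : ∀ i, P[Y i | G] =ᵐ[P] 0) (hint : Integrable (fun ω => ∑ i, U i ω * Y i ω) P) :
    ∫ ω, ∑ i, U i ω * Y i ω ∂P = 0 := by
  -- Truncation by a `G`-measurable event makes every summand integrable, so the pull-out property
  -- applies termwise. The events exhaust the space and the whole sum is integrable, so K → ∞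
  -- recovers the full integral.
  let A : ℕ → Set Ω := fun K => ⋂ i, {ω | |U i ω| ≤ K}
  have hA : ∀ K, MeasurableSet[G] (A K) := fun K =>
    @MeasurableSet.iInter _ _ G _ _ fun i =>
      (continuous_abs.measurable.comp (hU i)) measurableSet_Iic
  have hA' : ∀ K, MeasurableSet (A K) := fun K => hG _ (hA K)
  have hmono : Monotone A := fun K L hKL ω hω => by
    simp only [A, Set.mem_iInter, Set.mem_ofPred_eq] at hω ⊢
    exact fun i => (hω i).trans (by exact_mod_cast hKL)
  have hunion : (⋃ K, A K) = Set.univ := by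
    refine Set.eq_univ_of_forall fun ω => ?_
    obtain ⟨K, hK⟩ := exists_nat_ge (∑ i, |U i ω|)
    simp only [A, Set.mem_iUnion, Set.mem_iInter, Set.mem_ofPred_eq]
    exact ⟨K, fun i => (Finset.single_le_sum (f := fun i => |U i ω|) (fun j _ => abs_nonneg _)
      (Finset.mem_univ i)).trans hK⟩
  have hzero : ∀ K, ∫ ω in A K, ∑ i, U i ω * Y i ω ∂P = 0 := by
    intro K
    have hb : ∀ i ω, ‖(A K).indicator (U i) ω‖ ≤ K := by
      intro i ω
      by_cases h : ω ∈ A K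
      · rw [Set.indicator_of_mem h]
        simp only [A, Set.mem_iInter, Set.mem_ofPred_eq] at h
        exact h i
      · simp [h]
    have hi : ∀ i, Integrable ((A K).indicator (U i) * Y i) P := fun i =>
      (hY i).bdd_mul (((hU i).indicator (hA K)).mono hG le_rfl).aestronglyMeasurable
        (ae_of_all _ (hb i))
    calc ∫ ω in A K, ∑ i, U i ω * Y i ω ∂P
        = ∫ ω, ∑ i, (A K).indicator (U i) ω * Y i ω ∂P := by
          rw [← integral_indicator (hA' K)]
          refine integral_congr_ae (ae_of_all _ fun ω => ?_)
          by_cases h : ω ∈ A K <;> simp [h]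
      _ = ∑ i, ∫ ω, (A K).indicator (U i) ω * Y i ω ∂P := integral_finsetSum _ fun i _ => hi i
      _ = 0 := Finset.sum_eq_zero fun i _ =>
          integral_mul_eq_zero_of_condExp_eq_zero hG ((hU i).indicator (hA K)) (hi i) (hY i) (h0 i)
  have hlim := tendsto_setIntegral_of_monotone hA' hmono (f := fun ω => ∑ i, U i ω * Y i ω)
    (μ := P) hint.integrableOn
  simp_rw [hzero, hunion, setIntegral_univ] at hlim
  exact (tendsto_nhds_unique hlim tendsto_const_nhds)

end CondIndep

/-- The second moment of a sum of pairwise orthogonal variables with uniformly bounded second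
moments. -/
theorem lintegral_sum_sq_le {Ω κ : Type*} [MeasurableSpace Ω] {P : Measure Ω} (s : Finset κ)
    {Y : κ → Ω → ℝ}
    (hY : ∀ k ∈ s, Measurable (Y k)) {C : ℝ} (hC : 0 ≤ C)
    (hb : ∀ k ∈ s, ∫⁻ ω, ENNReal.ofReal (Y k ω ^ 2) ∂P ≤ ENNReal.ofReal C)
    (horth : ∀ k ∈ s, ∀ j ∈ s, k ≠ j → Integrable (fun ω => Y k ω * Y j ω) P →
      ∫ ω, Y k ω * Y j ω ∂P = 0) :
    ∫⁻ ω, ENNReal.ofReal ((∑ k ∈ s, Y k ω) ^ 2) ∂P ≤ ENNReal.ofReal (s.card * C) := by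
  classical
  have hsq : ∀ k ∈ s, Integrable (fun ω => Y k ω ^ 2) P := fun k hk =>
    ⟨((hY k hk).pow_const 2).aestronglyMeasurable, by
      rw [hasFiniteIntegral_iff_ofReal (ae_of_all _ fun ω => sq_nonneg _)]
      exact (hb k hk).trans_lt ENNReal.ofReal_lt_top⟩
  have hmem : ∀ k ∈ s, MemLp (Y k) 2 P := fun k hk =>
    (memLp_two_iff_integrable_sq (hY k hk).aestronglyMeasurable).2 (hsq k hk)
  -- The second-moment bounds supply the integrability of the products on which `horth` is
  -- conditional.
  have hprod : ∀ k ∈ s, ∀ j ∈ s, Integrable (fun ω => Y k ω * Y j ω) P := fun k hk j hj =>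
    (hmem k hk).integrable_mul (hmem j hj)
  have hle : ∀ k ∈ s, ∫ ω, Y k ω ^ 2 ∂P ≤ C := fun k hk => by
    rw [integral_eq_lintegral_of_nonneg_ae (ae_of_all _ fun ω => sq_nonneg _)
      (hsq k hk).aestronglyMeasurable]
    exact ENNReal.toReal_le_of_le_ofReal hC (hb k hk)
  have hexp : ∀ ω, (∑ k ∈ s, Y k ω) ^ 2 = ∑ k ∈ s, ∑ j ∈ s, Y k ω * Y j ω := fun ω => by
    rw [sq, Finset.sum_mul_sum]
  have hint : Integrable (fun ω => (∑ k ∈ s, Y k ω) ^ 2) P := by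
    simp_rw [hexp]
    exact integrable_finsetSum _ fun k hk => integrable_finsetSum _ fun j hj => hprod k hk j hj
  rw [← ofReal_integral_eq_lintegral_ofReal hint (ae_of_all _ fun ω => sq_nonneg _)]
  refine ENNReal.ofReal_le_ofReal ?_
  simp_rw [hexp]
  rw [integral_finsetSum _ fun k hk => integrable_finsetSum _ fun j hj => hprod k hk j hj]
  calc ∑ k ∈ s, ∫ ω, ∑ j ∈ s, Y k ω * Y j ω ∂P
      = ∑ k ∈ s, ∫ ω, Y k ω ^ 2 ∂P := by
        refine Finset.sum_congr rfl fun k hk => ?_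
        rw [integral_finsetSum _ fun j hj => hprod k hk j hj, Finset.sum_eq_single_of_mem k hk]
        · simp_rw [sq]
        · intro j hj hjk
          exact horth k hk j hj hjk.symm (hprod k hk j hj)
    _ ≤ ∑ k ∈ s, C := Finset.sum_le_sum hle
    _ = s.card * C := by simp

/-- A second-moment criterion for convergence in probability of scaled variables. -/
theorem tendsto_inProb_of_sq {ι : Type*} {Ω : ι → Type*} [∀ n, MeasurableSpace (Ω n)]
    {P : ∀ n, Measure (Ω n)} {l : Filter ι} {Y : ∀ n, Ω n → ℝ} (hY : ∀ n, Measurable (Y n))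
    {s b : ι → ℝ} (hb : ∀ᶠ n in l, ∫⁻ ω, ENNReal.ofReal (Y n ω ^ 2) ∂(P n) ≤ ENNReal.ofReal (b n))
    (hs : Tendsto (fun n => s n ^ 2 * b n) l (𝓝 0)) :
    Tendsto (fun x : Σ n, Ω n => s x.1 * Y x.1 x.2) (inProb P l) (𝓝 0) := by
  -- Markov's inequality is applied to the square; the square root then returns to the variable
  -- itself.
  have h : Tendsto (fun x : Σ n, Ω n => (s x.1 * Y x.1 x.2) ^ 2) (inProb P l) (𝓝 0) := by
    refine tendsto_inProb_of_lintegral (X := fun n ω => (s n * Y n ω) ^ 2)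
      (fun n => ((hY n).const_mul _).pow_const 2) hs ?_
    filter_upwards [hb] with n hn
    have e : ∀ ω, ‖(s n * Y n ω) ^ 2‖ₑ = ENNReal.ofReal (s n ^ 2) * ENNReal.ofReal (Y n ω ^ 2) :=
      fun ω => by
        rw [Real.enorm_eq_ofReal (sq_nonneg _), mul_pow, ENNReal.ofReal_mul (sq_nonneg _)]
    simp_rw [e]
    rw [lintegral_const_mul _ ((hY n).pow_const 2).ennreal_ofReal,
      ENNReal.ofReal_mul (sq_nonneg _)]
    gcongr
  have h2 := (Real.continuous_sqrt.tendsto 0).comp h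
  rw [Real.sqrt_zero] at h2
  rw [tendsto_zero_iff_abs_tendsto_zero]
  refine h2.congr fun x => ?_
  simp [Real.sqrt_sq_eq_abs]

theorem sq_apply_le_sq_norm {κ : Type*} [Fintype κ] (x : EuclideanSpace ℝ κ) (a : κ) :
    x a ^ 2 ≤ ‖x‖ ^ 2 := by
  rw [← sq_abs]
  exact pow_le_pow_left₀ (abs_nonneg _) (PiLp.norm_apply_le x a) 2

/-! ### Errors of one date, given the factors and the errors of all other dates -/

namespace FactorModel

variable {kF kv : ℕ} (M : FactorModel kF kv)

theorem sigmaFv_le (N T : ℕ) : M.sigmaFv N T ≤ M.mΩ N T :=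
  sup_le (iSup_le fun t => (M.measurable_F N T t).comap_le)
    (iSup_le fun t => (M.measurable_v N T t).comap_le)

/-- The error vector of date `t`. -/
def errVec (N T : ℕ) (t : Fin T) (ω : M.Ω N T) : Fin N → ℝ := fun i => M.e N T i t ω

theorem measurable_errVec (N T : ℕ) (t : Fin T) : Measurable (M.errVec N T t) :=
  measurable_pi_lambda _ fun i => M.measurable_e N T i t

/-- The sigma-algebra generated by all factors and by the errors of all dates but `t`. -/
@[reducible] def sigmaEx (N T : ℕ) (t : Fin T) : MeasurableSpace (M.Ω N T) :=
  sigmaOthers (M.errVec N T) (M.sigmaFv N T) t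

theorem sigmaEx_le (N T : ℕ) (t : Fin T) : M.sigmaEx N T t ≤ M.mΩ N T :=
  sigmaOthers_le (M.sigmaFv_le N T) (M.measurable_errVec N T) t

theorem condExp_sigmaEx (hE : M.Errors) (N T : ℕ) (i : Fin N) (t : Fin T) :
    (M.P N T)[M.e N T i t | M.sigmaEx N T t] =ᵐ[M.P N T] 0 :=
  IsCondIndep.condExp_sigmaOthers (X := M.errVec N T) (hE.cond_indep N T) (M.sigmaFv_le N T)
    (M.measurable_errVec N T) (g := fun x => x i) (measurable_pi_apply i)
    (M.integrable_e N T i t) (hE.cond_mean N T i t)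

/-- The regressor with index `c`: the constant or an observed factor. -/
noncomputable def reg (N T : ℕ) (c : Option (Fin kF)) (t : Fin T)
    (ω : M.Ω N T) : ℝ :=
  c.elim 1 fun a => M.F N T t ω a

theorem measurable_reg (N T : ℕ) (c : Option (Fin kF)) (t : Fin T) :
    Measurable[M.sigmaFv N T] (M.reg N T c t) := by
  cases c with
  | none => exact @measurable_const _ _ _ (M.sigmaFv N T) 1
  | some a =>
    have h : Measurable[M.sigmaFv N T] (M.F N T t) :=
      (comap_measurable (M.F N T t)).mono (le_sup_of_le_left (le_iSup (fun t =>
        MeasurableSpace.comap (M.F N T t) inferInstance) t)) le_rfl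
    exact (by fun_prop : Measurable fun x : Vec kF => x a).comp h

theorem measurable_reg_sigmaEx (N T : ℕ) (c : Option (Fin kF)) (t s : Fin T) :
    Measurable[M.sigmaEx N T t] (M.reg N T c s) :=
  (M.measurable_reg N T c s).mono (le_sigmaOthers t) le_rfl

theorem measurable_reg' (N T : ℕ) (c : Option (Fin kF)) (t : Fin T) :
    Measurable (M.reg N T c t) :=
  (M.measurable_reg N T c t).mono (M.sigmaFv_le N T) le_rfl

theorem measurable_e_sigmaEx (N T : ℕ) (i : Fin N) {t s : Fin T} (h : s ≠ t) :
    Measurable[M.sigmaEx N T t] (M.e N T i s) :=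
  (measurable_pi_apply i).comp
    ((comap_measurable (M.errVec N T s)).mono (comap_le_sigmaOthers h) le_rfl)

theorem reg_sq_le (N T : ℕ) (c : Option (Fin kF)) (t : Fin T) (ω : M.Ω N T) :
    M.reg N T c t ω ^ 2 ≤ 1 + ‖M.F N T t ω‖ ^ 2 := by
  cases c with
  | none => simp [reg]
  | some a =>
    have := sq_apply_le_sq_norm (M.F N T t ω) a
    simp only [reg, Option.elim]
    linarith

/-- A variable `∑ᵢ Uᵢ eᵢₜ` that is integrable has mean zero if the weights depend only on the
factors and the errors of other dates. -/
theorem integral_sum_mul_e (hE : M.Errors) {N T : ℕ} {t : Fin T} {U : Fin N → M.Ω N T → ℝ}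
    (hU : ∀ i, Measurable[M.sigmaEx N T t] (U i)) {Y : M.Ω N T → ℝ}
    (hY : ∀ ω, Y ω = ∑ i, U i ω * M.e N T i t ω) (hint : Integrable Y (M.P N T)) :
    ∫ ω, Y ω ∂(M.P N T) = 0 := by
  obtain rfl : Y = fun ω => ∑ i, U i ω * M.e N T i t ω := funext hY
  exact integral_sum_mul_eq_zero (M.sigmaEx_le N T t) hU (M.integrable_e N T · t)
    (M.condExp_sigmaEx hE N T · t) hint

/-! ### Loading-weighted errors -/

/-- The product of `Wₜ` and a regressor. -/
noncomputable def wReg (N T : ℕ) (a : Fin kF ⊕ Fin kv) (c : Option (Fin kF)) (t : Fin T)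
    (ω : M.Ω N T) : ℝ :=
  wAvg (M.γ N T) (M.es N T ω) t a * M.reg N T c t ω

/-- This is the form that `integral_sum_mul_e` needs: the errors of date `t` enter linearly, with
weights known given the factors. -/
theorem wReg_eq (N T : ℕ) (a : Fin kF ⊕ Fin kv) (c : Option (Fin kF)) (t : Fin T)
    (ω : M.Ω N T) : M.wReg N T a c t ω
      = ∑ i, ((Real.sqrt N)⁻¹ * M.γ N T i a * M.reg N T c t ω) * M.e N T i t ω := by
  simp only [wReg, wAvg, es, PiLp.smul_apply, WithLp.ofLp_sum, Finset.sum_apply, smul_eq_mul,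
    Finset.mul_sum, Finset.sum_mul, WithLp.ofLp_smul, Pi.smul_apply]
  exact Finset.sum_congr rfl fun i _ => by ring

theorem measurable_wReg_sigmaEx (N T : ℕ) (a : Fin kF ⊕ Fin kv) (c : Option (Fin kF))
    {t s : Fin T} (h : s ≠ t) : Measurable[M.sigmaEx N T t] (M.wReg N T a c s) := by
  rw [funext (M.wReg_eq N T a c s)]
  exact Finset.measurable_fun_sum _ fun i _ =>
    ((M.measurable_reg_sigmaEx N T c t s).const_mul _).mul (M.measurable_e_sigmaEx N T i h)

theorem measurable_wReg (N T : ℕ) (a : Fin kF ⊕ Fin kv) (c : Option (Fin kF)) (t : Fin T) :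
    Measurable (M.wReg N T a c t) := by
  rw [funext (M.wReg_eq N T a c t)]
  exact Finset.measurable_fun_sum _ fun i _ =>
    ((M.measurable_reg' N T c t).const_mul _).mul (M.measurable_e N T i t)

/-- The summands are orthogonal over dates and bounded in L² by ERRORS (iv), so the sum has second
moment at most T|C|. The squared scale is 1/(NT), which leaves |C|/N. -/
theorem tendsto_sum_wReg (hE : M.Errors) (a : Fin kF ⊕ Fin kv) (c : Option (Fin kF)) :
    Tendsto (fun x : Σ p, M.space p => ((Real.sqrt x.1.2)⁻¹ * (Real.sqrt x.1.1)⁻¹) *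
      ∑ t, M.wReg x.1.1 x.1.2 a c t x.2) (inProb M.prob atTop) (𝓝 0) := by
  obtain ⟨C, hC⟩ := hE.wAvg_moment
  refine tendsto_inProb_of_sq (Ω := M.space) (P := M.prob)
    (Y := fun p ω => ∑ t, M.wReg p.1 p.2 a c t ω)
    (s := fun p : ℕ × ℕ => (Real.sqrt p.2)⁻¹ * (Real.sqrt p.1)⁻¹)
    (b := fun p => p.2 * |C|)
    (fun p => Finset.measurable_fun_sum _ fun t _ => M.measurable_wReg _ _ a c t)
    (Eventually.of_forall fun p => ?_) ?_
  · have := lintegral_sum_sq_le (P := M.P p.1 p.2) Finset.univ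
      (fun t _ => M.measurable_wReg p.1 p.2 a c t) (abs_nonneg C) (fun t _ => ?_) ?_
    · simpa using this
    · refine (lintegral_mono fun ω => ENNReal.ofReal_le_ofReal ?_).trans
        ((hC p.1 p.2 t).trans (ENNReal.ofReal_le_ofReal (le_abs_self C)))
      have h1 := M.reg_sq_le p.1 p.2 c t ω
      have h2 : wAvg (M.γ p.1 p.2) (M.es p.1 p.2 ω) t a ^ 2
          ≤ ‖wAvg (M.γ p.1 p.2) (M.es p.1 p.2 ω) t‖ ^ 2 := sq_apply_le_sq_norm _ a
      rw [wReg, mul_pow, mul_comm]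
      gcongr
    · intro t _ s _ hts hint
      refine M.integral_sum_mul_e hE (t := t) (U := fun i ω =>
        (Real.sqrt p.1)⁻¹ * M.γ p.1 p.2 i a * M.reg p.1 p.2 c t ω * M.wReg p.1 p.2 a c s ω)
        (fun i => ((M.measurable_reg_sigmaEx _ _ c t t).const_mul _).mul
          (M.measurable_wReg_sigmaEx _ _ a c hts.symm)) (fun ω => ?_) hint
      rw [M.wReg_eq p.1 p.2 a c t, Finset.sum_mul]
      exact Finset.sum_congr rfl fun i _ => by ring
  · have h0 : Tendsto (fun p : ℕ × ℕ => (p.1 : ℝ)⁻¹ * |C|) atTop (𝓝 0) := by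
      have h1 : Tendsto (fun p : ℕ × ℕ => p.1) atTop atTop := by
        rw [← prod_atTop_atTop_eq]; exact tendsto_fst
      simpa using ((tendsto_inv_atTop_zero.comp
        (tendsto_natCast_atTop_atTop (R := ℝ))).comp h1).mul_const |C|
    refine h0.congr' ?_
    filter_upwards [eventually_ge_atTop ((1, 1) : ℕ × ℕ)] with p hp
    have hT : (0 : ℝ) < p.2 := by exact_mod_cast hp.2
    rw [mul_pow, inv_pow, inv_pow, Real.sq_sqrt (Nat.cast_nonneg _),
      Real.sq_sqrt (Nat.cast_nonneg _)]
    field_simp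

/-! ### Cross products of errors of different dates -/

/-- The product of `ρ(t,s)` and two regressors. -/
noncomputable def rhoReg (N T : ℕ) (c d : Option (Fin kF)) (p : Fin T × Fin T) (ω : M.Ω N T) : ℝ :=
  M.reg N T c p.1 ω * M.reg N T d p.2 ω * rho (M.es N T ω) p.1 p.2

theorem measurable_rhoReg (N T : ℕ) (c d : Option (Fin kF)) (p : Fin T × Fin T) :
    Measurable (M.rhoReg N T c d p) :=
  ((M.measurable_reg' N T c _).mul (M.measurable_reg' N T d _)).mul
    ((Finset.measurable_fun_sum _ fun i _ =>
      (M.measurable_e N T i _).mul (M.measurable_e N T i _)).const_mul _)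

theorem measurable_rhoReg_sigmaEx (N T : ℕ) (c d : Option (Fin kF)) {p : Fin T × Fin T}
    {t : Fin T} (h1 : p.1 ≠ t) (h2 : p.2 ≠ t) :
    Measurable[M.sigmaEx N T t] (M.rhoReg N T c d p) :=
  ((M.measurable_reg_sigmaEx N T c _ _).mul (M.measurable_reg_sigmaEx N T d _ _)).mul
    ((Finset.measurable_fun_sum _ fun i _ =>
      (M.measurable_e_sigmaEx N T i h1).mul (M.measurable_e_sigmaEx N T i h2)).const_mul _)

/-- Once everything but the errors of date `p.1` is fixed, ρ is linear in those errors, and the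
errors of date `p.2` are part of the weights. -/
theorem integral_rhoReg_mul_of_fst (hE : M.Errors) {N T : ℕ} (c d : Option (Fin kF))
    {p : Fin T × Fin T} (hp : p.2 ≠ p.1) {V : M.Ω N T → ℝ}
    (hV : Measurable[M.sigmaEx N T p.1] V)
    (hint : Integrable (fun ω => M.rhoReg N T c d p ω * V ω) (M.P N T)) :
    ∫ ω, M.rhoReg N T c d p ω * V ω ∂(M.P N T) = 0 := by
  refine M.integral_sum_mul_e hE (t := p.1) (U := fun i ω =>
    M.reg N T c p.1 ω * M.reg N T d p.2 ω * V ω * (Real.sqrt N)⁻¹ * M.e N T i p.2 ω)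
    (fun i => ((((M.measurable_reg_sigmaEx N T c _ _).mul
      (M.measurable_reg_sigmaEx N T d _ _)).mul hV).mul_const _).mul
      (M.measurable_e_sigmaEx N T i hp)) (fun ω => ?_) hint
  simp only [rhoReg, rho, es, Finset.mul_sum, Finset.sum_mul]
  exact Finset.sum_congr rfl fun i _ => by ring

theorem rho_comm {N T : ℕ} (e : Fin N → Fin T → ℝ) (t s : Fin T) : rho e t s = rho e s t := by
  simp only [rho, mul_comm]

theorem rhoReg_swap (N T : ℕ) (c d : Option (Fin kF)) (p : Fin T × Fin T) (ω : M.Ω N T) :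
    M.rhoReg N T c d p ω = M.rhoReg N T d c p.swap ω := by
  simp only [rhoReg, Prod.fst_swap, Prod.snd_swap, rho_comm _ p.1 p.2]
  ring

theorem integral_rhoReg_mul_of_snd (hE : M.Errors) {N T : ℕ} (c d : Option (Fin kF))
    {p : Fin T × Fin T} (hp : p.1 ≠ p.2) {V : M.Ω N T → ℝ}
    (hV : Measurable[M.sigmaEx N T p.2] V)
    (hint : Integrable (fun ω => M.rhoReg N T c d p ω * V ω) (M.P N T)) :
    ∫ ω, M.rhoReg N T c d p ω * V ω ∂(M.P N T) = 0 := by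
  simp_rw [M.rhoReg_swap N T c d p] at hint ⊢
  exact M.integral_rhoReg_mul_of_fst hE d c (p := p.swap) hp hV hint

/-- Some date occurs in exactly one of the two pairs: the larger of the two first dates if these
differ, and `p.2` if they agree. The errors of that date enter linearly and average out. -/
theorem integral_rhoReg_mul_rhoReg (hE : M.Errors) {N T : ℕ} (c d : Option (Fin kF))
    {p p' : Fin T × Fin T} (hp : p.2 < p.1) (hp' : p'.2 < p'.1) (hne : p ≠ p')
    (hint : Integrable (fun ω => M.rhoReg N T c d p ω * M.rhoReg N T c d p' ω) (M.P N T)) :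
    ∫ ω, M.rhoReg N T c d p ω * M.rhoReg N T c d p' ω ∂(M.P N T) = 0 := by
  rcases lt_trichotomy p.1 p'.1 with h | h | h
  · simp_rw [mul_comm (M.rhoReg N T c d p _)] at hint ⊢
    exact M.integral_rhoReg_mul_of_fst hE c d hp'.ne
      (M.measurable_rhoReg_sigmaEx N T c d h.ne (hp.trans h).ne) hint
  · refine M.integral_rhoReg_mul_of_snd hE c d hp.ne'
      (M.measurable_rhoReg_sigmaEx N T c d (h ▸ hp.ne') fun h2 => hne (Prod.ext h h2.symm)) hint
  · exact M.integral_rhoReg_mul_of_fst hE c d hp.ne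
      (M.measurable_rhoReg_sigmaEx N T c d h.ne (hp'.trans h).ne) hint

/-- The assumption weights ρ² by the factor of one date only. The inequality (1+f²)(1+g²) ≤ (1+f⁴) +
(1+g⁴) separates the two dates, and using the bound once for each ordering of the pair gives the
factor 2. -/
theorem lintegral_rhoReg_sq_le {C : ℝ} (hC : ∀ (N T : ℕ) (t s : Fin T), s ≠ t →
    ∫⁻ ω, ENNReal.ofReal ((1 + ‖M.F N T t ω‖ ^ 4) * (rho (M.es N T ω) s t ^ 2 + 1)) ∂(M.P N T)
      ≤ ENNReal.ofReal C) {N T : ℕ} (c d : Option (Fin kF)) {p : Fin T × Fin T}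
    (hp : p.2 ≠ p.1) :
    ∫⁻ ω, ENNReal.ofReal (M.rhoReg N T c d p ω ^ 2) ∂(M.P N T) ≤ ENNReal.ofReal (2 * |C|) := by
  have hle : ∀ ω, ENNReal.ofReal (M.rhoReg N T c d p ω ^ 2)
      ≤ ENNReal.ofReal ((1 + ‖M.F N T p.1 ω‖ ^ 4) * (rho (M.es N T ω) p.2 p.1 ^ 2 + 1))
        + ENNReal.ofReal ((1 + ‖M.F N T p.2 ω‖ ^ 4) * (rho (M.es N T ω) p.1 p.2 ^ 2 + 1)) := by
    intro ω
    rw [← ENNReal.ofReal_add (by positivity) (by positivity)]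
    refine ENNReal.ofReal_le_ofReal ?_
    have h1 := M.reg_sq_le N T c p.1 ω
    have h2 := M.reg_sq_le N T d p.2 ω
    rw [rhoReg, rho_comm _ p.2 p.1, ← add_mul, mul_pow, mul_pow]
    set f := ‖M.F N T p.1 ω‖
    set g := ‖M.F N T p.2 ω‖
    have h3 : (1 + f ^ 2) * (1 + g ^ 2) ≤ 1 + f ^ 4 + (1 + g ^ 4) := by
      nlinarith [sq_nonneg (f ^ 2 - g ^ 2), sq_nonneg (f ^ 2 - 1), sq_nonneg (g ^ 2 - 1)]
    calc M.reg N T c p.1 ω ^ 2 * M.reg N T d p.2 ω ^ 2 * rho (M.es N T ω) p.1 p.2 ^ 2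
        ≤ (1 + f ^ 2) * (1 + g ^ 2) * (rho (M.es N T ω) p.1 p.2 ^ 2 + 1) := by
          gcongr
          linarith
      _ ≤ _ := by gcongr
  refine (lintegral_mono hle).trans ?_
  rw [lintegral_add_right]
  · rw [two_mul, ENNReal.ofReal_add (abs_nonneg _) (abs_nonneg _)]
    exact add_le_add ((hC N T p.1 p.2 hp).trans (ENNReal.ofReal_le_ofReal (le_abs_self C)))
      ((hC N T p.2 p.1 hp.symm).trans (ENNReal.ofReal_le_ofReal (le_abs_self C)))
  · have h1 := M.measurable_F N T p.2
    have h2 : Measurable fun ω => rho (M.es N T ω) p.1 p.2 :=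
      (Finset.measurable_fun_sum _ fun i _ =>
        (M.measurable_e N T i _).mul (M.measurable_e N T i _)).const_mul _
    fun_prop

/-- Pairs of dates in decreasing order. -/
def datePairs (T : ℕ) : Finset (Fin T × Fin T) := Finset.univ.filter fun p => p.2 < p.1

/-- At most T² orthogonal terms, each with second moment at most 2|C|, against a squared scale of
1/(T³N): the bound 2|C|/(NT) vanishes however N and T grow. -/
theorem tendsto_sum_rhoReg (hE : M.Errors) (c d : Option (Fin kF)) :
    Tendsto (fun x : Σ p, M.space p =>
      ((Real.sqrt x.1.2)⁻¹ * (x.1.2 : ℝ)⁻¹ * (Real.sqrt x.1.1)⁻¹) *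
      ∑ q ∈ datePairs x.1.2, M.rhoReg x.1.1 x.1.2 c d q x.2) (inProb M.prob atTop) (𝓝 0) := by
  obtain ⟨C, hC⟩ := hE.rho_moment
  refine tendsto_inProb_of_sq (Ω := M.space) (P := M.prob)
    (Y := fun p ω => ∑ q ∈ datePairs p.2, M.rhoReg p.1 p.2 c d q ω)
    (s := fun p : ℕ × ℕ => (Real.sqrt p.2)⁻¹ * (p.2 : ℝ)⁻¹ * (Real.sqrt p.1)⁻¹)
    (b := fun p => p.2 ^ 2 * (2 * |C|))
    (fun p => Finset.measurable_fun_sum _ fun t _ => M.measurable_rhoReg _ _ c d t)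
    (Eventually.of_forall fun p => ?_) ?_
  · refine (lintegral_sum_sq_le (P := M.P p.1 p.2) (datePairs p.2)
      (fun q _ => M.measurable_rhoReg p.1 p.2 c d q) (C := 2 * |C|) (by positivity)
      (fun q hq => ?_) ?_).trans (ENNReal.ofReal_le_ofReal ?_)
    · simp only [datePairs, Finset.mem_filter, Finset.mem_univ, true_and] at hq
      exact M.lintegral_rhoReg_sq_le hC c d hq.ne
    · intro q hq q' hq' hne hint
      simp only [datePairs, Finset.mem_filter, Finset.mem_univ, true_and] at hq hq'
      exact M.integral_rhoReg_mul_rhoReg hE c d hq hq' hne hint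
    · gcongr
      have : (datePairs p.2).card ≤ p.2 ^ 2 := by
        refine (Finset.card_filter_le _ _).trans ?_
        simp [sq]
      exact_mod_cast this
  · have hinv : ∀ f : ℕ × ℕ → ℕ, Tendsto f atTop atTop →
        Tendsto (fun p => (f p : ℝ)⁻¹) atTop (𝓝 0) := fun f hf =>
      (tendsto_inv_atTop_zero.comp (tendsto_natCast_atTop_atTop (R := ℝ))).comp hf
    have h1 : Tendsto (fun p : ℕ × ℕ => p.1) atTop atTop := by
      rw [← prod_atTop_atTop_eq]; exact tendsto_fst
    have h2 : Tendsto (fun p : ℕ × ℕ => p.2) atTop atTop := by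
      rw [← prod_atTop_atTop_eq]; exact tendsto_snd
    have h0 := ((hinv _ h1).mul (hinv _ h2)).mul_const (2 * |C|)
    simp only [mul_zero, zero_mul] at h0
    refine h0.congr' ?_
    filter_upwards [eventually_ge_atTop ((1, 1) : ℕ × ℕ)] with p hp
    have hT : (0 : ℝ) < p.2 := by exact_mod_cast hp.2
    have hN : (0 : ℝ) < p.1 := by exact_mod_cast hp.1
    rw [mul_pow, mul_pow, inv_pow, inv_pow, inv_pow, Real.sq_sqrt (Nat.cast_nonneg _),
      Real.sq_sqrt (Nat.cast_nonneg _)]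
    field_simp

/-- The time averages of the observed factors are bounded in probability. -/
theorem stochBounded_timeMean (hE : M.Errors) (a : Fin kF) :
    StochBounded (inProb M.prob atTop) (fun x : Σ p, M.space p =>
      timeMean (fun t => M.F x.1.1 x.1.2 t x.2 a)) := by
  obtain ⟨C, hC⟩ := hE.rho_moment
  have hm : ∀ N T t, Measurable fun ω => M.F N T t ω a := fun N T t =>
    (by fun_prop : Measurable fun x : Vec kF => x a).comp (M.measurable_F N T t)
  refine StochBounded.of_lintegral (Ω := M.space) (P := M.prob)
    (X := fun p ω => timeMean (fun t => M.F p.1 p.2 t ω a))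
    (C := C) (fun p => ?_) ?_
  · simp only [timeMean, smul_eq_mul]
    exact (Finset.measurable_fun_sum _ fun t _ => hm _ _ t).const_mul _
  -- Two dates are needed: the uniform moment bound on F_t is read off from ERRORS (ii) for a pair
  -- (t, s) with s ≠ t.
  filter_upwards [eventually_ge_atTop ((1, 2) : ℕ × ℕ)] with p hp
  have hT : (0 : ℝ) < p.2 := by
    have : 0 < p.2 := lt_of_lt_of_le (by norm_num) hp.2
    exact_mod_cast this
  have hF : ∀ t, ∫⁻ ω, ‖M.F p.1 p.2 t ω a‖ₑ ∂(M.P p.1 p.2) ≤ ENNReal.ofReal C := by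
    intro t
    have : Nontrivial (Fin p.2) := Fin.nontrivial_iff_two_le.2 hp.2
    obtain ⟨s, hs⟩ := exists_ne t
    refine (lintegral_mono fun ω => ?_).trans (hC p.1 p.2 t s hs)
    rw [← ofReal_norm]
    refine ENNReal.ofReal_le_ofReal ?_
    have h1 := PiLp.norm_apply_le (M.F p.1 p.2 t ω) a
    set f := ‖M.F p.1 p.2 t ω‖
    have h2 : f ≤ 1 + f ^ 4 := by nlinarith [sq_nonneg (f ^ 2 - 1), sq_nonneg (f - 1)]
    have h3 : 1 + f ^ 4 ≤ (1 + f ^ 4) * (rho (M.es p.1 p.2 ω) s t ^ 2 + 1) :=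
      le_mul_of_one_le_right (by positivity) (by nlinarith [sq_nonneg (rho (M.es p.1 p.2 ω) s t)])
    linarith
  calc ∫⁻ ω, ‖timeMean (fun t => M.F p.1 p.2 t ω a)‖ₑ ∂(M.P p.1 p.2)
      ≤ ∫⁻ ω, ENNReal.ofReal (p.2 : ℝ)⁻¹ * ∑ t, ‖M.F p.1 p.2 t ω a‖ₑ ∂(M.P p.1 p.2) := by
        refine lintegral_mono fun ω => ?_
        simp only [timeMean, smul_eq_mul]
        rw [enorm_mul, Real.enorm_eq_ofReal (by positivity)]
        gcongr
        exact enorm_sum_le _ _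
    _ = ENNReal.ofReal (p.2 : ℝ)⁻¹ * ∑ t, ∫⁻ ω, ‖M.F p.1 p.2 t ω a‖ₑ ∂(M.P p.1 p.2) := by
        rw [lintegral_const_mul _ (Finset.measurable_fun_sum _ fun t _ => (hm _ _ t).enorm),
          lintegral_finsetSum _ fun t _ => (hm _ _ t).enorm]
    _ ≤ ENNReal.ofReal (p.2 : ℝ)⁻¹ * ∑ _t : Fin p.2, ENNReal.ofReal C := by
        gcongr with t
        exact hF t
    _ = ENNReal.ofReal C := by
        rw [Finset.sum_const, Finset.card_univ, Fintype.card_fin, nsmul_eq_mul, ← mul_assoc,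
          ← ENNReal.ofReal_natCast, ← ENNReal.ofReal_mul (by positivity), inv_mul_cancel₀ hT.ne',
          ENNReal.ofReal_one, one_mul]

end FactorModel

/-! ### Splitting double sums over dates into unequal and equal dates -/

theorem sum_sum_eq_sum_datePairs {T : ℕ} (f : Fin T → Fin T → ℝ) :
    ∑ t, ∑ s, f t s
      = ∑ q ∈ FactorModel.datePairs T, (f q.1 q.2 + f q.2 q.1) + ∑ t, f t t := by
  rw [← Finset.sum_product' (s := Finset.univ) (t := Finset.univ), Finset.univ_product_univ,
    ← Finset.sum_filter_add_sum_filter_not Finset.univ (fun q : Fin T × Fin T => q.2 < q.1),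
    ← Finset.sum_filter_add_sum_filter_not
      (Finset.univ.filter fun q : Fin T × Fin T => ¬ q.2 < q.1) (fun q => q.1 < q.2),
    Finset.sum_add_distrib, Finset.filter_filter, Finset.filter_filter, add_assoc]
  congr 1
  congr 1
  · refine Finset.sum_equiv (Equiv.prodComm _ _) (fun q => ?_) (fun q _ => rfl)
    simp only [FactorModel.datePairs, Finset.mem_filter, Finset.mem_univ, true_and,
      Equiv.prodComm_apply, Prod.fst_swap, Prod.snd_swap, not_lt]
    exact ⟨fun h => h.2, fun h => ⟨h.le, h⟩⟩
  · refine Finset.sum_bij' (fun q _ => q.1) (fun t _ => (t, t)) ?_ ?_ ?_ ?_ ?_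
    · simp
    · simp
    · rintro ⟨t, s⟩ h
      simp only [Finset.mem_filter, Finset.mem_univ, true_and, not_lt] at h
      exact Prod.ext rfl (le_antisymm h.1 h.2)
    · simp
    · rintro ⟨t, s⟩ h
      simp only [Finset.mem_filter, Finset.mem_univ, true_and, not_lt] at h
      have : t = s := le_antisymm h.1 h.2
      simp [this]

/-- The contribution of different dates to `√N` times the cross-sectional average of
`(∑ₜ eᵢₜ yₜ) (∑ₛ eᵢₛ zₛ)`. -/
noncomputable def offDiag {N T : ℕ} (e : Fin N → Fin T → ℝ) (y z : Fin T → ℝ) : ℝ :=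
  ∑ q ∈ FactorModel.datePairs T, (y q.1 * z q.2 + y q.2 * z q.1) * rho e q.1 q.2

theorem offDiag_comm {N T : ℕ} (e : Fin N → Fin T → ℝ) (y z : Fin T → ℝ) :
    offDiag e y z = offDiag e z y :=
  Finset.sum_congr rfl fun q _ => by ring

/-- Reduces demeaned factors to raw ones, at the cost of a term with the constant regressor and the
time mean as coefficient. -/
theorem offDiag_sub_const {N T : ℕ} (e : Fin N → Fin T → ℝ) (y z : Fin T → ℝ) (m : ℝ) :
    offDiag e (fun t => y t - m) z = offDiag e y z - m * offDiag e (fun _ => 1) z := by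
  simp only [offDiag, Finset.mul_sum, ← Finset.sum_sub_distrib]
  exact Finset.sum_congr rfl fun q _ => by ring

theorem inv_natCast_eq_inv_sqrt (n : ℕ) : (n : ℝ)⁻¹ = (Real.sqrt n)⁻¹ * (Real.sqrt n)⁻¹ := by
  rw [← mul_inv, Real.mul_self_sqrt (Nat.cast_nonneg n)]

theorem sqrt_mul_inv_natCast (n : ℕ) : Real.sqrt n * (n : ℝ)⁻¹ = (Real.sqrt n)⁻¹ := by
  rw [← div_eq_mul_inv, Real.sqrt_div_self', one_div]

/-- In the expanded product the cross-sectional average of e_it e_is is N^{-1/2} ρ(t,s) for t ≠ s,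
and it is S_t for t = s. -/
theorem average_mul_eq {N T : ℕ} (e : Fin N → Fin T → ℝ) (y z : Fin T → ℝ) :
    (N : ℝ)⁻¹ * ∑ i, (∑ t, e i t * y t) * (∑ t, e i t * z t)
      = (Real.sqrt N)⁻¹ * offDiag e y z + ∑ t, y t * z t * errVar e t := by
  have h : (N : ℝ)⁻¹ * ∑ i, (∑ t, e i t * y t) * (∑ t, e i t * z t)
      = ∑ t, ∑ s, y t * z s * ((N : ℝ)⁻¹ * ∑ i, e i t * e i s) := by
    simp_rw [Finset.sum_mul_sum, Finset.mul_sum]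
    rw [Finset.sum_comm]
    refine Finset.sum_congr rfl fun t _ => ?_
    rw [Finset.sum_comm]
    exact Finset.sum_congr rfl fun s _ => Finset.sum_congr rfl fun i _ => by ring
  rw [h, sum_sum_eq_sum_datePairs]
  congr 1
  · rw [offDiag, Finset.mul_sum]
    refine Finset.sum_congr rfl fun q _ => ?_
    have : ∑ i, e i q.2 * e i q.1 = ∑ i, e i q.1 * e i q.2 :=
      Finset.sum_congr rfl fun i _ => mul_comm _ _
    rw [this, rho, inv_natCast_eq_inv_sqrt]
    ring
  · refine Finset.sum_congr rfl fun t _ => ?_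
    simp only [errVar, sq]

/-! ### The four cross-sectional averages of the errors vanish at rate √T -/

namespace FactorModel

variable {kF kv : ℕ} (M : FactorModel kF kv)

/-- The events whose complements have vanishing probability as `N, T → ∞`. -/
abbrev lim : Filter (Σ p, M.space p) := inProb M.prob atTop

theorem tendsto_lim_fst (f : ℕ → ℝ) {c : ℝ} (hf : Tendsto f atTop (𝓝 c)) :
    Tendsto (fun x : Σ p, M.space p => f x.1.1) M.lim (𝓝 c) := by
  have h1 : Tendsto (fun p : ℕ × ℕ => p.1) atTop atTop := by
    rw [← prod_atTop_atTop_eq]; exact tendsto_fst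
  exact (hf.comp h1).comp tendsto_fst_inProb

theorem tendsto_lim_snd (f : ℕ → ℝ) {c : ℝ} (hf : Tendsto f atTop (𝓝 c)) :
    Tendsto (fun x : Σ p, M.space p => f x.1.2) M.lim (𝓝 c) := by
  have h1 : Tendsto (fun p : ℕ × ℕ => p.2) atTop atTop := by
    rw [← prod_atTop_atTop_eq]; exact tendsto_snd
  exact (hf.comp h1).comp tendsto_fst_inProb

theorem eventually_lim_pos : ∀ᶠ x : Σ p, M.space p in M.lim, 0 < x.1.1 ∧ 0 < x.1.2 := by
  refine tendsto_fst_inProb.eventually (p := fun p : ℕ × ℕ => 0 < p.1 ∧ 0 < p.2) ?_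
  filter_upwards [eventually_ge_atTop ((1, 1) : ℕ × ℕ)] with p hp using ⟨hp.1, hp.2⟩

theorem tendsto_inv_sqrt : Tendsto (fun n : ℕ => (Real.sqrt n)⁻¹) atTop (𝓝 0) :=
  tendsto_inv_atTop_zero.comp (Real.tendsto_sqrt_atTop.comp tendsto_natCast_atTop_atTop)

/-- The matrix of all loadings. -/
def loadMat (N T : ℕ) : Matrix (Fin N) (Fin kF ⊕ Fin kv) ℝ := Matrix.of fun i a => M.γ N T i a

/-- The matrix of errors. -/
def errMat (N T : ℕ) (ω : M.Ω N T) : Matrix (Fin N) (Fin T) ℝ := Matrix.of (M.es N T ω)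

/-- The matrix of demeaned observed factors. -/
noncomputable def demMat (N T : ℕ) (ω : M.Ω N T) : Matrix (Fin T) (Fin kF) ℝ :=
  Matrix.of fun t b => M.Ftil N T ω t b

/-- Time averages of the products of errors and demeaned factors. -/
noncomputable def errCov (N T : ℕ) (ω : M.Ω N T) : Matrix (Fin N) (Fin kF) ℝ :=
  (T : ℝ)⁻¹ • (M.errMat N T ω * M.demMat N T ω)

/-- Time averages of the errors. -/
noncomputable def errBar (N T : ℕ) (ω : M.Ω N T) : Fin N → ℝ :=
  (T : ℝ)⁻¹ • (M.errMat N T ω).mulVec 1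

theorem demMat_apply (N T : ℕ) (ω : M.Ω N T) (t : Fin T) (b : Fin kF) :
    M.demMat N T ω t b = M.F N T t ω b - timeMean (fun s => M.F N T s ω b) := by
  simp [demMat, Ftil, demean, timeMean, Fs]

theorem errCov_apply (N T : ℕ) (ω : M.Ω N T) (i : Fin N) (b : Fin kF) :
    M.errCov N T ω i b = (T : ℝ)⁻¹ * ∑ t, M.e N T i t ω * M.demMat N T ω t b := by
  simp [errCov, Matrix.mul_apply, errMat, es]

theorem errBar_apply (N T : ℕ) (ω : M.Ω N T) (i : Fin N) :
    M.errBar N T ω i = (T : ℝ)⁻¹ * ∑ t, M.e N T i t ω * 1 := by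
  simp [errBar, Matrix.mulVec, dotProduct, errMat, es]

theorem sqrt_average_eq (N T : ℕ) (ω : M.Ω N T) (a : Fin kF ⊕ Fin kv) (c : Option (Fin kF)) :
    Real.sqrt T * ((N : ℝ)⁻¹ * ∑ i, M.γ N T i a *
      ((T : ℝ)⁻¹ * ∑ t, M.e N T i t ω * M.reg N T c t ω))
      = ((Real.sqrt T)⁻¹ * (Real.sqrt N)⁻¹) * ∑ t, M.wReg N T a c t ω := by
  simp_rw [wReg_eq]
  simp only [Finset.mul_sum]
  rw [Finset.sum_comm]
  refine Finset.sum_congr rfl fun t _ => Finset.sum_congr rfl fun i _ => ?_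
  rw [inv_natCast_eq_inv_sqrt N, ← sqrt_mul_inv_natCast T]
  ring

theorem tendsto_loadMat_errBar (hE : M.Errors) :
    Tendsto (fun x : Σ p, M.space p => Real.sqrt x.1.2 • ((x.1.1 : ℝ)⁻¹ •
      (M.loadMat x.1.1 x.1.2).transpose.mulVec (M.errBar x.1.1 x.1.2 x.2))) M.lim (𝓝 0) := by
  rw [tendsto_pi_nhds]
  intro a
  refine (M.tendsto_sum_wReg hE a none).congr fun x => ?_
  rw [← sqrt_average_eq]
  simp [Matrix.mulVec, dotProduct, errBar_apply, loadMat, reg]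

/-- A demeaned factor is the raw factor minus its time mean times the constant; both regressors are
covered by `tendsto_sum_wReg`, and the mean is bounded in probability. -/
theorem tendsto_loadMat_errCov (hE : M.Errors) :
    Tendsto (fun x : Σ p, M.space p => Real.sqrt x.1.2 • ((x.1.1 : ℝ)⁻¹ •
      ((M.loadMat x.1.1 x.1.2).transpose * M.errCov x.1.1 x.1.2 x.2))) M.lim (𝓝 0) := by
  refine tendsto_pi_nhds.2 fun a => tendsto_pi_nhds.2 fun b => ?_
  have h := (M.tendsto_sum_wReg hE a (some b)).sub
    (M.stochBounded_timeMean hE b _ (M.tendsto_sum_wReg hE a none))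
  rw [sub_zero] at h
  refine h.congr fun x => ?_
  simp_rw [← sqrt_average_eq]
  simp only [Matrix.smul_apply, smul_eq_mul, Matrix.mul_apply, Matrix.transpose_apply,
    errCov_apply, demMat_apply, loadMat, Matrix.of_apply, reg, Option.elim, Finset.mul_sum,
    ← Finset.sum_sub_distrib]
  exact Finset.sum_congr rfl fun i _ => Finset.sum_congr rfl fun t _ => by ring

/-- `offDiag` counts each unordered pair of dates in both orders, hence the two sums with `c` and
`d` interchanged. -/
theorem tendsto_offDiag_reg (hE : M.Errors) (c d : Option (Fin kF)) :
    Tendsto (fun x : Σ p, M.space p =>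
      ((Real.sqrt x.1.2)⁻¹ * (x.1.2 : ℝ)⁻¹ * (Real.sqrt x.1.1)⁻¹) *
      offDiag (M.es x.1.1 x.1.2 x.2) (M.reg x.1.1 x.1.2 c · x.2) (M.reg x.1.1 x.1.2 d · x.2))
      M.lim (𝓝 0) := by
  have h := (M.tendsto_sum_rhoReg hE c d).add (M.tendsto_sum_rhoReg hE d c)
  rw [add_zero] at h
  refine h.congr fun x => ?_
  rw [← mul_add, ← Finset.sum_add_distrib, offDiag]
  congr 1
  exact Finset.sum_congr rfl fun q _ => by simp only [rhoReg]; ring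

theorem tendsto_offDiag_demMat_reg (hE : M.Errors) (a : Fin kF) (d : Option (Fin kF)) :
    Tendsto (fun x : Σ p, M.space p =>
      ((Real.sqrt x.1.2)⁻¹ * (x.1.2 : ℝ)⁻¹ * (Real.sqrt x.1.1)⁻¹) *
      offDiag (M.es x.1.1 x.1.2 x.2) (M.demMat x.1.1 x.1.2 x.2 · a)
        (M.reg x.1.1 x.1.2 d · x.2)) M.lim (𝓝 0) := by
  have h := (M.tendsto_offDiag_reg hE (some a) d).sub
    (M.stochBounded_timeMean hE a _ (M.tendsto_offDiag_reg hE none d))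
  rw [sub_zero] at h
  refine h.congr fun x => ?_
  simp only [demMat_apply, offDiag_sub_const]
  simp only [reg, Option.elim]
  ring

/-- The first series is already demeaned; the same subtraction is now made in the second one, after
using symmetry to bring it to the front. -/
theorem tendsto_offDiag_demMat (hE : M.Errors) (a b : Fin kF) :
    Tendsto (fun x : Σ p, M.space p =>
      ((Real.sqrt x.1.2)⁻¹ * (x.1.2 : ℝ)⁻¹ * (Real.sqrt x.1.1)⁻¹) *
      offDiag (M.es x.1.1 x.1.2 x.2) (M.demMat x.1.1 x.1.2 x.2 · a)
        (M.demMat x.1.1 x.1.2 x.2 · b)) M.lim (𝓝 0) := by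
  have h := (M.tendsto_offDiag_demMat_reg hE a (some b)).sub
    (M.stochBounded_timeMean hE b _ (M.tendsto_offDiag_demMat_reg hE a none))
  rw [sub_zero] at h
  refine h.congr fun x => ?_
  have e : offDiag (M.es x.1.1 x.1.2 x.2) (M.demMat x.1.1 x.1.2 x.2 · a)
      (M.demMat x.1.1 x.1.2 x.2 · b)
      = offDiag (M.es x.1.1 x.1.2 x.2) (fun t => M.F x.1.1 x.1.2 t x.2 b -
        timeMean (fun s => M.F x.1.1 x.1.2 s x.2 b)) (M.demMat x.1.1 x.1.2 x.2 · a) := by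
    rw [offDiag_comm]
    simp only [demMat_apply _ _ _ _ _ b]
  rw [e, offDiag_sub_const, offDiag_comm _ (fun _ => 1), offDiag_comm _ (fun t => M.F _ _ t _ b)]
  simp only [reg, Option.elim]
  ring

theorem tendsto_errCov_errBar (hE : M.Errors) :
    Tendsto (fun x : Σ p, M.space p => Real.sqrt x.1.2 • ((x.1.1 : ℝ)⁻¹ •
      (M.errCov x.1.1 x.1.2 x.2).transpose.mulVec (M.errBar x.1.1 x.1.2 x.2)))
      M.lim (𝓝 0) := by
  rw [tendsto_pi_nhds]
  intro b
  have h1 := tendstoInProb_iff.1 hE.errVar_mean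
  have h2 := (((by fun_prop : Continuous fun x : Vec kF => x b).tendsto 0).comp h1)
  -- Equal dates contribute T^{-3/2} ∑ F̃_t S_t, which is T^{-1/2} N^{-1/2} times the null variable
  -- of ERRORS (iii).
  have h3 := ((M.tendsto_lim_snd _ tendsto_inv_sqrt).mul
    (M.tendsto_lim_fst _ tendsto_inv_sqrt)).mul h2
  have h := (M.tendsto_offDiag_demMat_reg hE b none).add h3
  simp only [zero_mul, add_zero] at h
  refine h.congr' ?_
  filter_upwards [M.eventually_lim_pos] with x hx
  have hN : Real.sqrt x.1.1 ≠ 0 := (Real.sqrt_pos.2 (by exact_mod_cast hx.1)).ne'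
  have e := average_mul_eq (M.es x.1.1 x.1.2 x.2) (M.demMat x.1.1 x.1.2 x.2 · b)
    (M.reg x.1.1 x.1.2 none · x.2)
  have e2 : (Real.sqrt x.1.2 • ((x.1.1 : ℝ)⁻¹ •
      (M.errCov x.1.1 x.1.2 x.2).transpose.mulVec (M.errBar x.1.1 x.1.2 x.2))) b
      = (Real.sqrt x.1.2 * (x.1.2 : ℝ)⁻¹) * (x.1.2 : ℝ)⁻¹ * ((x.1.1 : ℝ)⁻¹ *
        ∑ i, (∑ t, M.es x.1.1 x.1.2 x.2 i t * M.demMat x.1.1 x.1.2 x.2 t b) *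
          (∑ t, M.es x.1.1 x.1.2 x.2 i t * M.reg x.1.1 x.1.2 none t x.2)) := by
    simp only [Pi.smul_apply, smul_eq_mul, Matrix.mulVec, dotProduct, Matrix.transpose_apply,
      errCov_apply, errBar_apply, reg, Option.elim, es]
    rw [Finset.mul_sum, Finset.mul_sum, Finset.mul_sum, Finset.mul_sum]
    exact Finset.sum_congr rfl fun i _ => by ring
  rw [e2, e, sqrt_mul_inv_natCast]
  have e3 : ((Real.sqrt x.1.1 / x.1.2) • ∑ t, errVar (M.es x.1.1 x.1.2 x.2) t •
      M.Ftil x.1.1 x.1.2 x.2 t) b = Real.sqrt x.1.1 * (x.1.2 : ℝ)⁻¹ *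
      ∑ t, M.demMat x.1.1 x.1.2 x.2 t b * M.reg x.1.1 x.1.2 none t x.2 *
        errVar (M.es x.1.1 x.1.2 x.2) t := by
    simp [demMat, reg, div_eq_mul_inv, mul_comm]
  simp only [Function.comp]
  rw [e3]
  field_simp

theorem tendsto_errCov_errCov (hE : M.Errors) :
    Tendsto (fun x : Σ p, M.space p => Real.sqrt x.1.2 • ((x.1.1 : ℝ)⁻¹ •
      ((M.errCov x.1.1 x.1.2 x.2).transpose * M.errCov x.1.1 x.1.2 x.2))) M.lim (𝓝 0) := by
  refine tendsto_pi_nhds.2 fun a => tendsto_pi_nhds.2 fun b => ?_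
  obtain ⟨SSF, hS⟩ := hE.errVar_sq
  have h1 := tendstoInProb_iff.1 (hS a b)
  -- Equal dates contribute T^{-1/2} times an average that converges by ERRORS (iii).
  have h := (M.tendsto_offDiag_demMat hE a b).add ((M.tendsto_lim_snd _ tendsto_inv_sqrt).mul h1)
  simp only [zero_mul, add_zero] at h
  refine h.congr fun x => ?_
  have e := average_mul_eq (M.es x.1.1 x.1.2 x.2) (M.demMat x.1.1 x.1.2 x.2 · a)
    (M.demMat x.1.1 x.1.2 x.2 · b)
  have e2 : (Real.sqrt x.1.2 • ((x.1.1 : ℝ)⁻¹ •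
      ((M.errCov x.1.1 x.1.2 x.2).transpose * M.errCov x.1.1 x.1.2 x.2))) a b
      = (Real.sqrt x.1.2 * (x.1.2 : ℝ)⁻¹) * (x.1.2 : ℝ)⁻¹ * ((x.1.1 : ℝ)⁻¹ *
        ∑ i, (∑ t, M.es x.1.1 x.1.2 x.2 i t * M.demMat x.1.1 x.1.2 x.2 t a) *
          (∑ t, M.es x.1.1 x.1.2 x.2 i t * M.demMat x.1.1 x.1.2 x.2 t b)) := by
    simp only [Matrix.smul_apply, smul_eq_mul, Matrix.mul_apply, Matrix.transpose_apply,
      errCov_apply, es]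
    rw [Finset.mul_sum, Finset.mul_sum, Finset.mul_sum, Finset.mul_sum]
    exact Finset.sum_congr rfl fun i _ => by ring
  have e3 : timeMean (fun t => errVar (M.es x.1.1 x.1.2 x.2) t •
      outer (M.Ftil x.1.1 x.1.2 x.2 t) (M.Ftil x.1.1 x.1.2 x.2 t)) a b
      = (x.1.2 : ℝ)⁻¹ * ∑ t, M.demMat x.1.1 x.1.2 x.2 t a * M.demMat x.1.1 x.1.2 x.2 t b *
        errVar (M.es x.1.1 x.1.2 x.2) t := by
    simp [timeMean, Matrix.sum_apply, outer, Matrix.vecMulVec_apply, demMat, mul_comm]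
  rw [e2, e, sqrt_mul_inv_natCast, e3]
  ring

end FactorModel

/-! ### Algebra of the two-pass estimator -/

section Expansion

open Matrix

variable {n τ k m : Type*} [Fintype n] [Fintype τ] [Fintype k] [Fintype m] [DecidableEq k]

/-- The matrix that maps the loadings to the systematic part of the first-pass estimates. -/
noncomputable def passMat (w : ℝ) (S SF : Matrix k k ℝ) (η : Matrix k m ℝ) :
    Matrix (k ⊕ m) k ℝ :=
  fromRows 1 (w • (ηᵀ * SFᵀ) * S⁻¹)

/-- The cross moment of the first-pass estimates and the loadings. -/
noncomputable def crossMoment (w : ℝ) (S SF : Matrix k k ℝ) (η : Matrix k m ℝ)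
    (Lh : Matrix (k ⊕ m) (k ⊕ m) ℝ) (q : Matrix (k ⊕ m) k ℝ) : Matrix k (k ⊕ m) ℝ :=
  (passMat w S SF η)ᵀ * Lh + S⁻¹ * (w • qᵀ)

/-- The cross moment of the first-pass estimates and the error covariances, times `S`. -/
noncomputable def errMoment (w : ℝ) (S SF : Matrix k k ℝ) (η : Matrix k m ℝ)
    (q : Matrix (k ⊕ m) k ℝ) (K : Matrix k k ℝ) : Matrix k k ℝ :=
  (passMat w S SF η)ᵀ * q + S⁻¹ * K

/-- The second moment of the first-pass estimates. -/
noncomputable def secondMoment (w : ℝ) (S SF : Matrix k k ℝ) (η : Matrix k m ℝ)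
    (Lh : Matrix (k ⊕ m) (k ⊕ m) ℝ) (q : Matrix (k ⊕ m) k ℝ) (K : Matrix k k ℝ) :
    Matrix k k ℝ :=
  crossMoment w S SF η Lh q * passMat w S SF η + w • errMoment w S SF η q K * S⁻¹

/-- The scaled estimation error of the two-pass estimator, relative to the ex-post risk premia. -/
noncomputable def scaledError (w : ℝ) (S SF : Matrix k k ℝ) (η : Matrix k m ℝ) (ηv : m → ℝ)
    (Lh : Matrix (k ⊕ m) (k ⊕ m) ℝ) (q : Matrix (k ⊕ m) k ℝ) (K : Matrix k k ℝ)
    (p : k ⊕ m → ℝ) (r lt : k → ℝ) : k → ℝ :=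
  (secondMoment w S SF η Lh q K)⁻¹ *ᵥ
    (crossMoment w S SF η Lh q *ᵥ Sum.elim 0 (ηv - ηᵀ *ᵥ (SFᵀ *ᵥ (S⁻¹ *ᵥ lt)))
      + ((passMat w S SF η)ᵀ *ᵥ p + S⁻¹ *ᵥ r) - errMoment w S SF η q K *ᵥ (S⁻¹ *ᵥ lt))

/-- An exact identity, read with s = √T, w = T^{-1/2}, c = 1/N and `lt` = λ̃. Insert B = GJ + QS⁻¹
into the normal equations of the second pass. The arguments `q`, `K`, `p`, `r` are the averages G'Q,
Q'Q, G'ē, Q'ē scaled by √T/N, so all that remains for the limit is to let them vanish. -/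
theorem twoPass_expansion {G : Matrix n (k ⊕ m) ℝ} {E R : Matrix n τ ℝ} {D : Matrix τ k ℝ}
    {V : Matrix τ m ℝ} {lt : k → ℝ} {s w c : ℝ} (hs : s * w = 1)
    (hT : w * w * (Fintype.card τ : ℝ) = 1) (hD : Dᵀ *ᵥ 1 = 0)
    (hR : R = G * fromRows (Matrix.of fun a t => lt a + D t a) Vᵀ + E)
    {S SF : Matrix k k ℝ} (hS : S = (w * w) • (Dᵀ * D)) (hSdet : IsUnit S.det)
    {η : Matrix k m ℝ} (hη : ηᵀ * SFᵀ = w • (Vᵀ * D)) {B : Matrix n k ℝ}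
    (hB : B = ((w * w) • (R * D)) * S⁻¹) {Lh : Matrix (k ⊕ m) (k ⊕ m) ℝ} (hL : Lh = c • (Gᵀ * G))
    {q : Matrix (k ⊕ m) k ℝ} (hq : q = s • (c • (Gᵀ * ((w * w) • (E * D)))))
    {K : Matrix k k ℝ} (hK : K = s • (c • (((w * w) • (E * D))ᵀ * ((w * w) • (E * D)))))
    {p : k ⊕ m → ℝ} (hp : p = s • (c • (Gᵀ *ᵥ ((w * w) • (E *ᵥ 1)))))
    {r : k → ℝ} (hr : r = s • (c • (((w * w) • (E * D))ᵀ *ᵥ ((w * w) • (E *ᵥ 1)))))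
    (hdet : IsUnit (secondMoment w S SF η Lh q K).det) :
    s • ((Bᵀ * B)⁻¹ *ᵥ (Bᵀ *ᵥ ((w * w) • (R *ᵥ 1))) - lt)
      = scaledError w S SF η (w • (Vᵀ *ᵥ 1)) Lh q K p r lt := by
  set Q := (w * w) • (E * D) with hQ
  set eb := (w * w) • (E *ᵥ 1) with heb
  set J := passMat w S SF η with hJ
  have hsym : (S⁻¹)ᵀ = S⁻¹ := by
    rw [transpose_nonsing_inv, hS, transpose_smul, transpose_mul, transpose_transpose]
  clear_value Q eb J
  have hq' : w • qᵀ = c • (Qᵀ * G) := by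
    rw [hq, transpose_smul, smul_smul, mul_comm, hs, one_smul, transpose_smul, transpose_mul,
      transpose_transpose]
  -- First-pass estimates as linear images of the loadings plus estimation noise. The constant
  -- premium λ̃ drops out because the demeaned factors sum to zero.
  have hBJ : B = G * J + Q * S⁻¹ := by
    have h1 : ∀ a, ∑ t, D t a = 0 := fun a => by
      have := congrFun hD a
      simpa [mulVec, dotProduct] using this
    have hrow : (Matrix.of fun a t => lt a + D t a) * D = Dᵀ * D := by
      ext a b
      simp [Matrix.mul_apply, add_mul, Finset.sum_add_distrib, ← Finset.mul_sum, h1]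
    have h2 : fromRows ((w * w) • (Dᵀ * D)) ((w * w) • (Vᵀ * D)) * S⁻¹ = J := by
      rw [fromRows_mul, ← hS, mul_nonsing_inv _ hSdet, hJ, passMat, hη, smul_smul]
    have h3 : (w * w) • (fromRows (Dᵀ * D) (Vᵀ * D))
        = fromRows ((w * w) • (Dᵀ * D)) ((w * w) • (Vᵀ * D)) := by
      ext i j
      cases i <;> simp
    rw [hB, hR, Matrix.add_mul, Matrix.mul_assoc G, fromRows_mul, hrow, smul_add, Matrix.add_mul,
      ← Matrix.mul_smul, h3, Matrix.mul_assoc G, h2, ← hQ]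
  have hz : w • (Vᵀ *ᵥ 1) - ηᵀ *ᵥ (SFᵀ *ᵥ (S⁻¹ *ᵥ lt))
      = s • ((w * w) • (Vᵀ *ᵥ 1) - (w • (ηᵀ * SFᵀ) * S⁻¹) *ᵥ lt) := by
    rw [smul_sub, smul_smul, ← mul_assoc, hs, one_mul, Matrix.smul_mul, smul_mulVec, smul_smul, hs,
      one_smul, ← mulVec_mulVec, ← mulVec_mulVec]
  -- Mean returns are centred at Bλ̃ rather than at the true betas times λ̃, so what the missing
  -- factors and the noise do to B reappears with a minus sign in the remainder.
  have hrb : (w * w) • (R *ᵥ 1) = B *ᵥ lt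
      + (G *ᵥ Sum.elim (0 : k → ℝ) ((w * w) • (Vᵀ *ᵥ 1) - (w • (ηᵀ * SFᵀ) * S⁻¹) *ᵥ lt)
      + (eb - Q *ᵥ (S⁻¹ *ᵥ lt))) := by
    have h1 : (w * w) • (fromRows (Matrix.of fun a t => lt a + D t a) Vᵀ *ᵥ 1)
        = J *ᵥ lt + Sum.elim (0 : k → ℝ) ((w * w) • (Vᵀ *ᵥ 1) - (w • (ηᵀ * SFᵀ) * S⁻¹) *ᵥ lt) := by
      ext i
      cases i with
      | inl a =>
        have h2 := congrFun hD a
        simp only [mulVec, dotProduct, transpose_apply, Pi.one_apply, mul_one,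
          Pi.zero_apply] at h2
        have h3 : (J *ᵥ lt) (Sum.inl a) = lt a := by
          rw [hJ, passMat, fromRows_mulVec]
          simp
        rw [Pi.add_apply, h3]
        simp only [Sum.elim_inl, Pi.zero_apply, add_zero, Pi.smul_apply,
          smul_eq_mul, mulVec, dotProduct, fromRows_apply_inl, of_apply, Pi.one_apply, mul_one,
          Finset.sum_add_distrib, h2, Finset.sum_const, Finset.card_univ, nsmul_eq_mul]
        rw [← mul_assoc, hT, one_mul]
      | inr b =>
        have h3 : (J *ᵥ lt) (Sum.inr b) = ((w • (ηᵀ * SFᵀ) * S⁻¹) *ᵥ lt) b := by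
          rw [hJ, passMat, fromRows_mulVec]
          simp
        rw [Pi.add_apply, h3, Sum.elim_inr, Pi.sub_apply, add_sub_cancel, fromRows_mulVec]
        simp
    rw [hR, add_mulVec, smul_add, ← mulVec_mulVec, ← mulVec_smul, h1, mulVec_add, hBJ,
      add_mulVec, mulVec_mulVec, mulVec_mulVec, ← heb]
    abel
  have hBG : c • (Bᵀ * G) = crossMoment w S SF η Lh q := by
    rw [crossMoment, ← hJ, hBJ, transpose_add, transpose_mul, transpose_mul, hsym, Matrix.add_mul,
      smul_add, hL, hq', Matrix.mul_smul, Matrix.mul_smul, Matrix.mul_assoc, Matrix.mul_assoc]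
  have hBQ : s • (c • (Bᵀ * Q)) = errMoment w S SF η q K := by
    rw [errMoment, ← hJ, hBJ, transpose_add, transpose_mul, transpose_mul, hsym, Matrix.add_mul,
      smul_add, smul_add, hq, hK, Matrix.mul_smul, Matrix.mul_smul, Matrix.mul_smul,
      Matrix.mul_smul, Matrix.mul_assoc, Matrix.mul_assoc]
  have hBe : s • (c • (Bᵀ *ᵥ eb)) = Jᵀ *ᵥ p + S⁻¹ *ᵥ r := by
    rw [hBJ, transpose_add, transpose_mul, transpose_mul, hsym, add_mulVec, smul_add, smul_add,
      hp, hr, mulVec_smul, mulVec_smul, mulVec_smul, mulVec_smul, mulVec_mulVec, mulVec_mulVec]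
  have hBB : c • (Bᵀ * B) = secondMoment w S SF η Lh q K := by
    have : Bᵀ * B = Bᵀ * G * J + Bᵀ * Q * S⁻¹ := by
      rw [Matrix.mul_assoc, Matrix.mul_assoc, ← Matrix.mul_add, ← hBJ]
    rw [this, smul_add, ← Matrix.smul_mul c (Bᵀ * G), ← Matrix.smul_mul c (Bᵀ * Q), hBG,
      secondMoment, ← hJ, ← hBQ, smul_smul w s, mul_comm w s, hs, one_smul]
  have hunit : IsUnit (Bᵀ * B).det := by
    rw [← hBB, det_smul] at hdet
    exact (IsUnit.mul_iff.1 hdet).2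
  have hinv : (Bᵀ * B)⁻¹ = (secondMoment w S SF η Lh q K)⁻¹ * (c • (1 : Matrix k k ℝ)) := by
    rw [← hBB]
    refine Matrix.inv_eq_left_inv ?_
    rw [Matrix.mul_assoc, Matrix.smul_mul, Matrix.one_mul]
    refine nonsing_inv_mul _ ?_
    rw [hBB]
    exact hdet
  -- The regression on B fits Bλ̃ without error, so λ̃ cancels from the estimation error.
  have hlt : (Bᵀ * B)⁻¹ *ᵥ (Bᵀ *ᵥ (B *ᵥ lt)) = lt := by
    rw [mulVec_mulVec lt Bᵀ B, mulVec_mulVec, nonsing_inv_mul _ hunit, one_mulVec]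
  rw [hrb, mulVec_add, mulVec_add, hlt, add_sub_cancel_left, scaledError, hinv, ← mulVec_mulVec,
    ← mulVec_smul, hz, ← hJ]
  congr 1
  rw [smul_mulVec, one_mulVec, mulVec_add, mulVec_sub, ← hBe, ← hBQ, ← hBG]
  have h0 : Sum.elim (0 : k → ℝ) (s • ((w * w) • (Vᵀ *ᵥ 1) - (w • (ηᵀ * SFᵀ) * S⁻¹) *ᵥ lt))
      = s • Sum.elim (0 : k → ℝ) ((w * w) • (Vᵀ *ᵥ 1) - (w • (ηᵀ * SFᵀ) * S⁻¹) *ᵥ lt) := by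
    ext i
    cases i <;> simp
  rw [h0, mulVec_smul, smul_mulVec, smul_mulVec, smul_mulVec, mulVec_mulVec, ← mulVec_mulVec _ Bᵀ Q,
    smul_add, smul_sub, smul_add, smul_sub]
  abel

end Expansion

/-! ### Limits of the matrix expansion -/

section Limits

open Matrix

variable {α : Type*} {L : Filter α} {a b c : Type*}

theorem tendsto_matrix_mul [Fintype a] {X : α → Matrix c a ℝ} {Y : α → Matrix a b ℝ}
    {X₀ : Matrix c a ℝ}
    {Y₀ : Matrix a b ℝ} (hX : Tendsto X L (𝓝 X₀)) (hY : Tendsto Y L (𝓝 Y₀)) :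
    Tendsto (fun x => X x * Y x) L (𝓝 (X₀ * Y₀)) :=
  ((continuous_fst.matrix_mul continuous_snd).tendsto (X₀, Y₀)).comp (hX.prodMk_nhds hY)

theorem tendsto_matrix_mulVec [Fintype a] {X : α → Matrix c a ℝ} {y : α → a → ℝ} {X₀ : Matrix c a ℝ}
    {y₀ : a → ℝ} (hX : Tendsto X L (𝓝 X₀)) (hy : Tendsto y L (𝓝 y₀)) :
    Tendsto (fun x => X x *ᵥ y x) L (𝓝 (X₀ *ᵥ y₀)) :=
  ((continuous_fst.matrix_mulVec continuous_snd).tendsto (X₀, y₀)).comp (hX.prodMk_nhds hy)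

theorem tendsto_matrix_transpose {X : α → Matrix a b ℝ} {X₀ : Matrix a b ℝ}
    (hX : Tendsto X L (𝓝 X₀)) : Tendsto (fun x => (X x)ᵀ) L (𝓝 X₀ᵀ) :=
  (continuous_id.matrix_transpose.tendsto X₀).comp hX

theorem tendsto_matrix_inv [Fintype a] [DecidableEq a] {X : α → Matrix a a ℝ} {X₀ : Matrix a a ℝ}
    (hX : Tendsto X L (𝓝 X₀)) (h₀ : IsUnit X₀.det) :
    Tendsto (fun x => (X x)⁻¹) L (𝓝 X₀⁻¹) := by
  have hdet : Tendsto (fun x => (X x).det) L (𝓝 X₀.det) :=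
    (continuous_id.matrix_det.tendsto X₀).comp hX
  have hadj : Tendsto (fun x => (X x).adjugate) L (𝓝 X₀.adjugate) :=
    (continuous_id.matrix_adjugate.tendsto X₀).comp hX
  simp only [Matrix.inv_def, Ring.inverse_eq_inv']
  exact (hdet.inv₀ h₀.ne_zero).smul hadj

theorem eventually_isUnit_det [Fintype a] [DecidableEq a] {X : α → Matrix a a ℝ} {X₀ : Matrix a a ℝ}
    (hX : Tendsto X L (𝓝 X₀)) (h₀ : IsUnit X₀.det) : ∀ᶠ x in L, IsUnit (X x).det := by
  have hdet : Tendsto (fun x => (X x).det) L (𝓝 X₀.det) :=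
    (continuous_id.matrix_det.tendsto X₀).comp hX
  filter_upwards [hdet.eventually_ne h₀.ne_zero] with x hx using hx.isUnit

theorem StochBounded.sum {ι : Type*} (s : Finset ι) {X : ι → α → ℝ}
    (h : ∀ i ∈ s, StochBounded L (X i)) : StochBounded L (fun x => ∑ i ∈ s, X i x) := by
  intro Y hY
  simp_rw [Finset.sum_mul]
  rw [← Finset.sum_const_zero (s := s)]
  exact tendsto_finsetSum _ fun i hi => h i hi Y hY

theorem StochBounded.mul {X X' : α → ℝ} (h : StochBounded L X) (h' : StochBounded L X') :
    StochBounded L (fun x => X x * X' x) := fun Y hY => by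
  simpa only [mul_assoc] using h _ (h' Y hY)

theorem StochBounded.sub {X X' : α → ℝ} (h : StochBounded L X) (h' : StochBounded L X') :
    StochBounded L (fun x => X x - X' x) := fun Y hY => by
  simpa [sub_mul] using (h Y hY).sub (h' Y hY)

theorem tendsto_mulVec_zero_of_stochBounded [Fintype a] {X : α → Matrix c a ℝ} {y : α → a → ℝ}
    (hX : Tendsto X L (𝓝 0)) (hy : ∀ j, StochBounded L (fun x => y x j)) :
    Tendsto (fun x => X x *ᵥ y x) L (𝓝 0) := by
  rw [tendsto_pi_nhds]
  intro i
  have hX' : ∀ j, Tendsto (fun x => X x i j) L (𝓝 0) := fun j =>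
    tendsto_pi_nhds.1 (tendsto_pi_nhds.1 hX i) j
  have := tendsto_finsetSum Finset.univ fun j _ => hy j _ (hX' j)
  simp only [Finset.sum_const_zero] at this
  refine this.congr fun x => ?_
  simp [mulVec, dotProduct, mul_comm]

theorem tendsto_mulVec_zero_of_stochBounded' [Fintype a] {X : α → Matrix c a ℝ} {y : α → a → ℝ}
    (hX : ∀ i j, StochBounded L (fun x => X x i j)) (hy : Tendsto y L (𝓝 0)) :
    Tendsto (fun x => X x *ᵥ y x) L (𝓝 0) := by
  rw [tendsto_pi_nhds]
  intro i
  have := tendsto_finsetSum Finset.univ fun j _ => hX i j _ (tendsto_pi_nhds.1 hy j)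
  simp only [Finset.sum_const_zero] at this
  exact this

variable {k m : Type*} [Fintype k] [Fintype m] [DecidableEq k]

/-- η and ηv are only bounded in probability, so they stay on both sides instead of passing to a
limit. Their contribution is linear with convergent coefficients, and a null coefficient times a
bounded variable is null. Inside J, η carries the factor w → 0, hence J → (I; 0) and J'Γ reduces to
the first block row of Γ. -/
theorem tendsto_scaledError {w : α → ℝ} {S K : α → Matrix k k ℝ} {SF : Matrix k k ℝ}
    {η : α → Matrix k m ℝ} {ηv : α → m → ℝ} {Lh : α → Matrix (k ⊕ m) (k ⊕ m) ℝ}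
    {Γ : Matrix (k ⊕ m) (k ⊕ m) ℝ} {q : α → Matrix (k ⊕ m) k ℝ} {p : α → k ⊕ m → ℝ}
    {r lt : α → k → ℝ} {lam : k → ℝ} (hw : Tendsto w L (𝓝 0)) (hS : Tendsto S L (𝓝 SF))
    (hSF : IsUnit SF.det) (hsym : SFᵀ = SF) (hη : ∀ i j, StochBounded L (fun x => η x i j))
    (hηv : ∀ j, StochBounded L (fun x => ηv x j)) (hL : Tendsto Lh L (𝓝 Γ))
    (hΓ : IsUnit Γ.toBlocks₁₁.det) (hq : Tendsto q L (𝓝 0)) (hK : Tendsto K L (𝓝 0))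
    (hp : Tendsto p L (𝓝 0)) (hr : Tendsto r L (𝓝 0)) (hlt : Tendsto lt L (𝓝 lam)) :
    (∀ᶠ x in L, IsUnit (secondMoment (w x) (S x) SF (η x) (Lh x) (q x) (K x)).det) ∧
    Tendsto (fun x => scaledError (w x) (S x) SF (η x) (ηv x) (Lh x) (q x) (K x) (p x) (r x) (lt x)
      - (Γ.toBlocks₁₁⁻¹ * Γ.toBlocks₁₂) *ᵥ (ηv x - (η x)ᵀ *ᵥ lam)) L (𝓝 0) := by
  have hSi := tendsto_matrix_inv hS hSF
  have hwη : Tendsto (fun x => w x • ((η x)ᵀ * SFᵀ)) L (𝓝 0) := by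
    have h1 : Tendsto (fun x => w x • (η x)ᵀ) L (𝓝 0) := by
      refine tendsto_pi_nhds.2 fun i => tendsto_pi_nhds.2 fun j => ?_
      refine (hη j i w hw).congr fun x => ?_
      simp [mul_comm]
    have := tendsto_matrix_mul h1 (tendsto_const_nhds (x := SFᵀ))
    simpa [Matrix.smul_mul] using this
  set J₀ : Matrix (k ⊕ m) k ℝ := fromRows 1 0 with hJ₀
  have hJ : Tendsto (fun x => passMat (w x) (S x) SF (η x)) L (𝓝 J₀) := by
    have h1 := tendsto_matrix_mul hwη hSi
    rw [Matrix.zero_mul] at h1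
    refine tendsto_pi_nhds.2 fun i => ?_
    cases i with
    | inl i => exact tendsto_const_nhds
    | inr i => exact tendsto_pi_nhds.1 h1 i
  have hC : Tendsto (fun x => crossMoment (w x) (S x) SF (η x) (Lh x) (q x)) L (𝓝 (J₀ᵀ * Γ)) := by
    have h1 := hw.smul (tendsto_matrix_transpose hq)
    rw [zero_smul] at h1
    have := (tendsto_matrix_mul (tendsto_matrix_transpose hJ) hL).add (tendsto_matrix_mul hSi h1)
    rwa [Matrix.mul_zero, add_zero] at this
  have hM : Tendsto (fun x => errMoment (w x) (S x) SF (η x) (q x) (K x)) L (𝓝 0) := by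
    have := (tendsto_matrix_mul (tendsto_matrix_transpose hJ) hq).add (tendsto_matrix_mul hSi hK)
    rwa [Matrix.mul_zero, Matrix.mul_zero, add_zero] at this
  have hJΓ : J₀ᵀ * Γ = fromCols Γ.toBlocks₁₁ Γ.toBlocks₁₂ := by
    conv_lhs => rw [← fromBlocks_toBlocks Γ]
    rw [hJ₀, transpose_fromRows, fromCols_mul_fromBlocks]
    simp
  have hB : Tendsto (fun x => secondMoment (w x) (S x) SF (η x) (Lh x) (q x) (K x)) L
      (𝓝 Γ.toBlocks₁₁) := by
    have h1 := tendsto_matrix_mul (hw.smul hM) hSi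
    have := (tendsto_matrix_mul hC hJ).add h1
    rwa [zero_smul, Matrix.zero_mul, add_zero, hJΓ, hJ₀, fromCols_mul_fromRows, Matrix.mul_one,
      Matrix.mul_zero, add_zero] at this
  refine ⟨eventually_isUnit_det hB hΓ, ?_⟩
  have hBi := tendsto_matrix_inv hB hΓ
  have hslt := tendsto_matrix_mulVec hSi hlt
  -- Consistency of S and symmetry of Σ_F make Σ_F' S⁻¹ λ̃ consistent for λ.
  have hx : Tendsto (fun x => SFᵀ *ᵥ ((S x)⁻¹ *ᵥ lt x) - lam) L (𝓝 0) := by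
    have h1 := (tendsto_matrix_mulVec (tendsto_const_nhds (x := SFᵀ)) hslt).sub_const lam
    have e : SFᵀ *ᵥ (SF⁻¹ *ᵥ lam) - lam = 0 := by
      rw [mulVec_mulVec, hsym, mul_nonsing_inv _ hSF, one_mulVec, sub_self]
    rwa [e] at h1
  -- the terms that do not involve the missing factors
  have hrest : Tendsto (fun x => (secondMoment (w x) (S x) SF (η x) (Lh x) (q x) (K x))⁻¹ *ᵥ
      ((passMat (w x) (S x) SF (η x))ᵀ *ᵥ p x + (S x)⁻¹ *ᵥ r x
        - errMoment (w x) (S x) SF (η x) (q x) (K x) *ᵥ ((S x)⁻¹ *ᵥ lt x))) L (𝓝 0) := by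
    have := tendsto_matrix_mulVec hBi
      (((tendsto_matrix_mulVec (tendsto_matrix_transpose hJ) hp).add
        (tendsto_matrix_mulVec hSi hr)).sub (tendsto_matrix_mulVec hM hslt))
    simpa using this
  -- the missing factors
  set D : α → Matrix k (k ⊕ m) ℝ := fun x =>
    (secondMoment (w x) (S x) SF (η x) (Lh x) (q x) (K x))⁻¹ *
      crossMoment (w x) (S x) SF (η x) (Lh x) (q x) with hD
  set D₀ : Matrix k (k ⊕ m) ℝ := Γ.toBlocks₁₁⁻¹ * (J₀ᵀ * Γ) with hD₀
  have hDlim : Tendsto (fun x => D x - D₀) L (𝓝 0) := by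
    have := (tendsto_matrix_mul hBi hC).sub_const D₀
    rwa [← hD₀, sub_self] at this
  have hz₀ : ∀ j, StochBounded L (fun x => (ηv x - (η x)ᵀ *ᵥ lam) j) := fun j => by
    refine (hηv j).sub ?_
    simp only [mulVec, dotProduct, transpose_apply]
    exact StochBounded.sum _ fun i _ => (hη i j).mul (StochBounded.of_tendsto tendsto_const_nhds)
  have hd : Tendsto (fun x => (η x)ᵀ *ᵥ (SFᵀ *ᵥ ((S x)⁻¹ *ᵥ lt x) - lam)) L (𝓝 0) :=
    tendsto_mulVec_zero_of_stochBounded' (fun i j => hη j i) hx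
  have helim : ∀ y : α → m → ℝ, (∀ j, StochBounded L (fun x => y x j)) →
      ∀ i, StochBounded L (fun x => (Sum.elim (0 : k → ℝ) (y x)) i) := by
    intro y hy i
    cases i with
    | inl i => exact StochBounded.of_tendsto tendsto_const_nhds
    | inr i => exact hy i
  have h1 := tendsto_mulVec_zero_of_stochBounded hDlim (helim _ hz₀)
  have h2 : Tendsto (fun x => D x *ᵥ Sum.elim (0 : k → ℝ)
      ((η x)ᵀ *ᵥ (SFᵀ *ᵥ ((S x)⁻¹ *ᵥ lt x) - lam))) L (𝓝 0) := by
    have h3 : Tendsto (fun x => Sum.elim (0 : k → ℝ)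
        ((η x)ᵀ *ᵥ (SFᵀ *ᵥ ((S x)⁻¹ *ᵥ lt x) - lam))) L (𝓝 0) := by
      refine tendsto_pi_nhds.2 fun i => ?_
      cases i with
      | inl i => exact tendsto_const_nhds
      | inr i => exact tendsto_pi_nhds.1 hd i
    simpa using tendsto_matrix_mulVec (tendsto_matrix_mul hBi hC) h3
  -- With z₀ = ηv - η'λ and δ = Σ_F' S⁻¹ λ̃ - λ, the missing-factor term minus its target is (D -
  -- D₀)(0; z₀) - D(0; η'δ), and both parts are null.
  have := (h1.sub h2).add hrest
  simp only [sub_zero, add_zero] at this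
  refine this.congr fun x => ?_
  have hz : Sum.elim (0 : k → ℝ) (ηv x - (η x)ᵀ *ᵥ (SFᵀ *ᵥ ((S x)⁻¹ *ᵥ lt x)))
      = Sum.elim (0 : k → ℝ) (ηv x - (η x)ᵀ *ᵥ lam)
        - Sum.elim (0 : k → ℝ) ((η x)ᵀ *ᵥ (SFᵀ *ᵥ ((S x)⁻¹ *ᵥ lt x) - lam)) := by
    ext i
    cases i with
    | inl i => simp
    | inr i => simp [mulVec_sub]
  have hlim : (Γ.toBlocks₁₁⁻¹ * Γ.toBlocks₁₂) *ᵥ (ηv x - (η x)ᵀ *ᵥ lam)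
      = D₀ *ᵥ Sum.elim (0 : k → ℝ) (ηv x - (η x)ᵀ *ᵥ lam) := by
    rw [hD₀, hJΓ, ← mulVec_mulVec, ← mulVec_mulVec, fromCols_mulVec]
    simp
  rw [scaledError, hz, hlim, sub_mulVec, hD]
  simp only [mulVec_sub, mulVec_add, ← mulVec_mulVec]
  abel

end Limits

/-! ### Measurability of the estimator -/

/-- Adjugate over determinant is measurable everywhere: at singular matrices the reciprocal of the
determinant takes its default value 0. -/
theorem measurable_inv_apply {Ω k : Type*} [MeasurableSpace Ω] [Fintype k] [DecidableEq k]
    {A : Ω → Matrix k k ℝ} (hA : ∀ i j, Measurable fun ω => A ω i j) (i j : k) :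
    Measurable fun ω => (A ω)⁻¹ i j := by
  have hA' : Measurable fun ω (i j : k) => A ω i j :=
    measurable_pi_lambda _ fun i => measurable_pi_lambda _ fun j => hA i j
  have hdet : Continuous fun X : k → k → ℝ => (Matrix.of X).det :=
    Continuous.matrix_det continuous_id
  have hadj : Continuous fun X : k → k → ℝ => (Matrix.of X).adjugate i j :=
    (Continuous.matrix_adjugate continuous_id).matrix_elem i j
  simp only [Matrix.inv_def, Ring.inverse_eq_inv', Matrix.smul_apply, smul_eq_mul]
  exact (hdet.measurable.comp hA').inv.mul (hadj.measurable.comp hA')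

theorem measurable_act {Ω m n : Type*} [MeasurableSpace Ω] [Fintype m] [Fintype n]
    {A : Ω → Matrix m n ℝ} (hA : ∀ i j, Measurable fun ω => A ω i j)
    {x : Ω → EuclideanSpace ℝ n} (hx : ∀ j, Measurable fun ω => x ω j) :
    Measurable fun ω => act (A ω) (x ω) := by
  refine (WithLp.measurable_toLp 2 _).comp (measurable_pi_lambda _ fun i => ?_)
  simp only [Matrix.mulVec, dotProduct]
  exact Finset.measurable_fun_sum _ fun j _ => (hA i j).mul (hx j)

theorem measurable_lambdaTP {Ω : Type*} [MeasurableSpace Ω] {kF N T : ℕ}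
    {f : Ω → Fin T → Vec kF} {r : Ω → Fin N → Fin T → ℝ}
    (hf : ∀ t a, Measurable fun ω => f ω t a) (hr : ∀ i t, Measurable fun ω => r ω i t) :
    Measurable fun ω => lambdaTP (f ω) (r ω) := by
  have hd : ∀ t a, Measurable fun ω => demean (f ω) t a := fun t a => by
    simp only [demean, timeMean, PiLp.sub_apply, PiLp.smul_apply, WithLp.ofLp_sum,
      Finset.sum_apply, smul_eq_mul]
    exact (hf t a).sub ((Finset.measurable_fun_sum _ fun s _ => hf s a).const_mul _)
  have happ : ∀ {m : ℕ} {g : Ω → Vec m}, Measurable g → ∀ a, Measurable fun ω => g ω a :=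
    fun hg a => (by fun_prop : Measurable fun x : Vec _ => x a).comp hg
  have hb : ∀ i, Measurable fun ω => betaHat (f ω) (r ω i) := fun i => by
    refine measurable_act (measurable_inv_apply fun a b => ?_) fun a => ?_
    · simp only [Matrix.sum_apply, outer, Matrix.vecMulVec_apply]
      exact Finset.measurable_fun_sum _ fun t _ => (hd t a).mul (hd t b)
    · simp only [WithLp.ofLp_sum, Finset.sum_apply, PiLp.smul_apply, smul_eq_mul]
      exact Finset.measurable_fun_sum _ fun t _ => (hr i t).mul (hd t a)
  refine measurable_act (measurable_inv_apply fun a b => ?_) fun a => ?_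
  · simp only [Matrix.sum_apply, outer, Matrix.vecMulVec_apply]
    exact Finset.measurable_fun_sum _ fun i _ => (happ (hb i) a).mul (happ (hb i) b)
  · simp only [WithLp.ofLp_sum, Finset.sum_apply, PiLp.smul_apply, smul_eq_mul, timeMean]
    exact Finset.measurable_fun_sum _ fun i _ =>
      ((Finset.measurable_fun_sum _ fun t _ => hr i t).const_mul _).mul (happ (hb i) a)

/-- `ovLimit` as a continuous linear function of `(vec η, ηv)`. -/
noncomputable def ovMap {kF kv : ℕ} (Γ : Matrix (Fin kF ⊕ Fin kv) (Fin kF ⊕ Fin kv) ℝ)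
    (lam : Vec kF) : (EuclideanSpace ℝ (Fin kv × Fin kF) × Vec kv) →L[ℝ] Vec kF :=
  LinearMap.toContinuousLinearMap
    { toFun := fun z => ovLimit Γ lam (Matrix.of fun a b => z.1 (b, a)) z.2
      map_add' := fun z z' => by
        ext i
        simp only [ovLimit, act, Matrix.mulVec, dotProduct, Matrix.transpose_apply,
          Matrix.of_apply, Prod.fst_add, Prod.snd_add, PiLp.add_apply, PiLp.sub_apply, add_mul,
          Finset.sum_add_distrib]
        rw [← Finset.sum_add_distrib]
        exact Finset.sum_congr rfl fun j _ => by ring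
      map_smul' := fun c z => by
        ext i
        simp only [ovLimit, act, Matrix.mulVec, dotProduct, Matrix.transpose_apply,
          Matrix.of_apply, Prod.smul_fst, Prod.smul_snd, PiLp.smul_apply, PiLp.sub_apply,
          smul_eq_mul, RingHom.id_apply, mul_assoc, ← Finset.mul_sum]
        rw [Finset.mul_sum]
        exact Finset.sum_congr rfl fun j _ => by ring }

/-! ### The estimator and the returns in matrix form -/

namespace FactorModel

open Matrix

variable {kF kv : ℕ} (M : FactorModel kF kv)

theorem measurable_scaledTP (p : ℕ × ℕ) : Measurable (M.scaledTP p) := by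
  have hF : ∀ N T t a, Measurable fun ω => M.F N T t ω a := fun N T t a =>
    (by fun_prop : Measurable fun x : Vec kF => x a).comp (M.measurable_F N T t)
  have hlam : Measurable (M.lamTP p.1 p.2) → Measurable (M.scaledTP p) := fun h =>
    Measurable.const_smul (show Measurable fun ω => M.lamTP p.1 p.2 ω - M.lam from
      h.sub_const _) (Real.sqrt p.2)
  refine hlam (measurable_lambdaTP (f := M.Fs p.1 p.2) (r := M.rs p.1 p.2)
    (fun t a => hF _ _ t a) fun i t => ?_)
  have h1 := M.measurable_F p.1 p.2 t
  have h2 := M.measurable_v p.1 p.2 t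
  have h3 := M.measurable_e p.1 p.2 i t
  simp only [rs, M.return_eq]
  fun_prop

theorem scaledTilde_eq (p : ℕ × ℕ) (ω : M.space p) :
    M.scaledTilde p ω = M.factorSum p.1 p.2 ω := by
  rw [scaledTilde, lamTilde, add_sub_cancel_left, timeMean, factorSum, smul_smul,
    sqrt_mul_inv_natCast]

/-- The matrix of missing factors. -/
def missMat (N T : ℕ) (ω : M.Ω N T) : Matrix (Fin T) (Fin kv) ℝ :=
  Matrix.of fun t b => M.v N T t ω b

/-- The sample covariance matrix of the observed factors. -/
noncomputable def sampleCov (N T : ℕ) (ω : M.Ω N T) : Matrix (Fin kF) (Fin kF) ℝ :=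
  ((Real.sqrt T)⁻¹ * (Real.sqrt T)⁻¹) • ((M.demMat N T ω)ᵀ * M.demMat N T ω)

theorem transpose_demMat_mulVec_one {T : ℕ} (hT : 0 < T) (N : ℕ) (ω : M.Ω N T) :
    (M.demMat N T ω)ᵀ *ᵥ 1 = 0 := by
  ext a
  have hT' : (T : ℝ) ≠ 0 := by exact_mod_cast hT.ne'
  simp only [mulVec, dotProduct, transpose_apply, Pi.one_apply, mul_one, demMat_apply, timeMean,
    Finset.sum_sub_distrib, Finset.sum_const, Finset.card_univ, Fintype.card_fin, smul_eq_mul,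
    nsmul_eq_mul, Pi.zero_apply]
  rw [mul_inv_cancel_left₀ hT', sub_self]

theorem sum_outer_demMat (N T : ℕ) (ω : M.Ω N T) :
    ∑ t, outer (demean (M.Fs N T ω) t) (demean (M.Fs N T ω) t)
      = (M.demMat N T ω)ᵀ * M.demMat N T ω := by
  ext a b
  simp [Matrix.sum_apply, outer, vecMulVec_apply, Matrix.mul_apply, demMat, Ftil]

theorem sum_outer_loadMat (N T : ℕ) :
    ∑ i, outer (M.γ N T i) (M.γ N T i) = (M.loadMat N T)ᵀ * M.loadMat N T := by
  ext a b
  simp [Matrix.sum_apply, outer, vecMulVec_apply, Matrix.mul_apply, loadMat]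

theorem etaT_eq (SF : Matrix (Fin kF) (Fin kF) ℝ) (N T : ℕ) (ω : M.Ω N T) :
    M.etaT SF N T ω = (Real.sqrt T)⁻¹ • (SF⁻¹ * ((M.demMat N T ω)ᵀ * M.missMat N T ω)) := by
  rw [etaT, ← Matrix.mul_sum]
  congr 2
  ext a b
  simp [Matrix.sum_apply, outer, vecMulVec_apply, Matrix.mul_apply, demMat, missMat]

theorem ofLp_etavT (N T : ℕ) (ω : M.Ω N T) :
    (M.etavT N T ω).ofLp = (Real.sqrt T)⁻¹ • ((M.missMat N T ω)ᵀ *ᵥ 1) := by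
  ext b
  simp [etavT, mulVec, dotProduct, missMat]

variable {M}

/-- The first-pass estimates in matrix form. -/
noncomputable def betaMat (M : FactorModel kF kv) (N T : ℕ) (ω : M.Ω N T) :
    Matrix (Fin N) (Fin kF) ℝ :=
  (((Real.sqrt T)⁻¹ * (Real.sqrt T)⁻¹) • (Matrix.of (M.rs N T ω) * M.demMat N T ω)) *
    (M.sampleCov N T ω)⁻¹

/-- The factor 1/T cancels between moment matrix and cross moments, and symmetry of S⁻¹ turns its
action on columns into multiplication of rows from the right. -/
theorem ofLp_betaHat {N T : ℕ} (ω : M.Ω N T) (hS : IsUnit (M.sampleCov N T ω).det)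
    (i : Fin N) : (betaHat (M.Fs N T ω) (M.rs N T ω i)).ofLp = M.betaMat N T ω i := by
  have hA : ((M.demMat N T ω)ᵀ * M.demMat N T ω)⁻¹
      = ((Real.sqrt T)⁻¹ * (Real.sqrt T)⁻¹) • (M.sampleCov N T ω)⁻¹ := by
    refine Matrix.inv_eq_left_inv ?_
    rw [Matrix.smul_mul, ← Matrix.mul_smul, ← sampleCov, nonsing_inv_mul _ hS]
  have hsym : ((M.sampleCov N T ω)⁻¹)ᵀ = (M.sampleCov N T ω)⁻¹ := by
    rw [transpose_nonsing_inv, sampleCov, transpose_smul, transpose_mul, transpose_transpose]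
  have hv : (∑ t, M.rs N T ω i t • demean (M.Fs N T ω) t).ofLp
      = (Matrix.of (M.rs N T ω) * M.demMat N T ω) i := by
    ext a
    simp [Matrix.mul_apply, demMat, Ftil]
  rw [betaHat, act, sum_outer_demMat, hv, hA, ← hsym, ← transpose_smul, mulVec_transpose,
    betaMat, Matrix.smul_mul, ← Matrix.mul_smul]
  rfl

theorem ofLp_lamTP {N T : ℕ} (ω : M.Ω N T) (hS : IsUnit (M.sampleCov N T ω).det) :
    (M.lamTP N T ω).ofLp = ((M.betaMat N T ω)ᵀ * M.betaMat N T ω)⁻¹ *ᵥ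
      ((M.betaMat N T ω)ᵀ *ᵥ (((Real.sqrt T)⁻¹ * (Real.sqrt T)⁻¹) •
        (Matrix.of (M.rs N T ω) *ᵥ 1))) := by
  have h1 : ∑ i, outer (betaHat (M.Fs N T ω) (M.rs N T ω i)) (betaHat (M.Fs N T ω) (M.rs N T ω i))
      = (M.betaMat N T ω)ᵀ * M.betaMat N T ω := by
    ext a b
    simp [Matrix.sum_apply, outer, vecMulVec_apply, Matrix.mul_apply, ofLp_betaHat ω hS]
  have h2 : (∑ i, timeMean (M.rs N T ω i) • betaHat (M.Fs N T ω) (M.rs N T ω i)).ofLp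
      = (M.betaMat N T ω)ᵀ *ᵥ (((Real.sqrt T)⁻¹ * (Real.sqrt T)⁻¹) •
        (Matrix.of (M.rs N T ω) *ᵥ 1)) := by
    ext a
    simp [mulVec, dotProduct, timeMean, ofLp_betaHat ω hS, ← inv_natCast_eq_inv_sqrt, mul_comm]
  rw [lamTP, lambdaTP, act, h1, h2]

/-- Strict stationarity makes the mean of the factors constant. -/
theorem integral_eq_of_isStationary {N T : ℕ} (h : IsStationary (M.F N T) (M.P N T))
    (t t' : Fin T) :
    ∫ ω, M.F N T t ω ∂(M.P N T) = ∫ ω, M.F N T t' ω ∂(M.P N T) := by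
  have key : ∀ t : Fin T, (M.P N T).map (M.F N T t)
      = (M.P N T).map (M.F N T ⟨0, t.pos⟩) := fun t => by
    have h1 := congrArg (Measure.map fun x : Fin 1 → Vec kF => x 0) (h t 1 t.isLt)
    rwa [Measure.map_map (measurable_pi_apply 0)
        (measurable_pi_lambda _ fun j => M.measurable_F _ _ _),
      Measure.map_map (measurable_pi_apply 0)
        (measurable_pi_lambda _ fun j => M.measurable_F _ _ _)] at h1
  have h2 : ∀ t : Fin T, ∫ ω, M.F N T t ω ∂(M.P N T) = ∫ x, x ∂((M.P N T).map (M.F N T t)) :=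
    fun t => (integral_map (M.measurable_F N T t).aemeasurable
      aestronglyMeasurable_id).symm
  rw [h2, h2, key t, key t']

/-- The ex-post risk premia, as a sum. -/
theorem returns_eq {N T : ℕ} (h : IsStationary (M.F N T) (M.P N T)) (ω : M.Ω N T) :
    Matrix.of (M.rs N T ω) = M.loadMat N T *
      fromRows (Matrix.of fun a t => M.lamTilde N T ω a + M.demMat N T ω t a)
        (M.missMat N T ω)ᵀ + M.errMat N T ω := by
  ext i t
  have hT : (T : ℝ) ≠ 0 := by exact_mod_cast t.pos.ne'
  -- By stationarity all EF_s equal EF_t, so λ + F_t - EF_t and λ̃ + F̃_t agree at every date.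
  have hm : M.lamTilde N T ω = M.lam + (timeMean (fun t => M.F N T t ω)
      - ∫ ω', M.F N T t ω' ∂(M.P N T)) := by
    rw [lamTilde, timeMean, Finset.sum_sub_distrib,
      Finset.sum_congr rfl fun s _ => integral_eq_of_isStationary h s t, Finset.sum_const,
      Finset.card_univ, Fintype.card_fin, ← Nat.cast_smul_eq_nsmul ℝ, smul_sub, smul_smul,
      inv_mul_cancel₀ hT, one_smul, timeMean]
  have hd : ∀ a, M.demMat N T ω t a = M.F N T t ω a - timeMean (fun t => M.F N T t ω) a :=
    fun a => rfl
  simp only [of_apply, rs, M.return_eq, Matrix.add_apply, Matrix.mul_apply, Fintype.sum_sum_type,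
    fromRows_apply_inl, fromRows_apply_inr, hm, hd, loadMat, γ, Sum.elim_inl, Sum.elim_inr,
    PiLp.inner_apply, transpose_apply, missMat, errMat, es, PiLp.add_apply, PiLp.sub_apply,
    RCLike.inner_apply, conj_trivial]
  rw [← Finset.sum_add_distrib]
  congr 2
  exact Finset.sum_congr rfl fun a _ => by ring

end FactorModel

/-! ### From the assumptions to the asymptotic expansion -/

namespace FactorModel

open Matrix

variable {kF kv : ℕ} {M : FactorModel kF kv} {SF OmF : Matrix (Fin kF) (Fin kF) ℝ}
  {OmvF : Matrix (Fin kv × Fin kF) (Fin kv × Fin kF) ℝ}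
  {Γ : Matrix (Fin kF ⊕ Fin kv) (Fin kF ⊕ Fin kv) ℝ}
  {Ω' : Type*} [MeasurableSpace Ω'] {P' : Measure Ω'} [IsProbabilityMeasure P']
  {Z : Ω' → Vec kF} {η : Ω' → Matrix (Fin kF) (Fin kv) ℝ} {ηv : Ω' → Vec kv}

theorem Factors.transpose_eq (hF : M.Factors SF OmF OmvF P' Z η ηv) : SFᵀ = SF := by
  ext a b
  -- Any date of any sample serves; N = 0, T = 1 is the smallest choice that has one.
  rw [transpose_apply, ← hF.cov_eq 0 1 0 a b, ← hF.cov_eq 0 1 0 b a, covariance_comm]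

theorem Factors.tendsto_sampleCov (hF : M.Factors SF OmF OmvF P' Z η ηv) :
    Tendsto (fun x : Σ p, M.space p => M.sampleCov x.1.1 x.1.2 x.2) M.lim (𝓝 SF) := by
  refine tendsto_pi_nhds.2 fun a => tendsto_pi_nhds.2 fun b => ?_
  refine (tendstoInProb_iff.1 (hF.sample_cov a b)).congr fun x => ?_
  have := M.sum_outer_demMat x.1.1 x.1.2 x.2
  rw [sampleCov, ← this, ← inv_natCast_eq_inv_sqrt]
  rfl

theorem Factors.stochBounded_of_joint (hF : M.Factors SF OmF OmvF P' Z η ηv)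
    {g : Vec kF × EuclideanSpace ℝ (Fin kv × Fin kF) × Vec kv → ℝ} (hg : Continuous g) :
    StochBounded M.lim (fun x : Σ p, M.space p => g (M.factorSum x.1.1 x.1.2 x.2,
      WithLp.toLp 2 (M.etaT SF x.1.1 x.1.2 x.2).vec, M.etavT x.1.1 x.1.2 x.2)) :=
  StochBounded.of_tendstoInDistribution (Ω := M.space) (P := M.prob)
    (X := fun p ω => g (M.factorSum p.1 p.2 ω,
      WithLp.toLp 2 (M.etaT SF p.1 p.2 ω).vec, M.etavT p.1 p.2 ω))
    (hF.joint.continuous_comp hg)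

theorem Factors.stochBounded_factorSum (hF : M.Factors SF OmF OmvF P' Z η ηv) (a : Fin kF) :
    StochBounded M.lim (fun x : Σ p, M.space p => M.factorSum x.1.1 x.1.2 x.2 a) :=
  hF.stochBounded_of_joint (g := fun z => z.1 a) (by fun_prop)

theorem Factors.stochBounded_etaT (hF : M.Factors SF OmF OmvF P' Z η ηv) (a : Fin kF)
    (b : Fin kv) :
    StochBounded M.lim (fun x : Σ p, M.space p => M.etaT SF x.1.1 x.1.2 x.2 a b) :=
  hF.stochBounded_of_joint (g := fun z => z.2.1 (b, a)) (by fun_prop)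

theorem Factors.stochBounded_etavT (hF : M.Factors SF OmF OmvF P' Z η ηv) (b : Fin kv) :
    StochBounded M.lim (fun x : Σ p, M.space p => M.etavT x.1.1 x.1.2 x.2 b) :=
  hF.stochBounded_of_joint (g := fun z => z.2.2 b) (by fun_prop)

theorem lamTilde_eq (p : ℕ × ℕ) (ω : M.space p) :
    M.lamTilde p.1 p.2 ω = M.lam + (Real.sqrt p.2)⁻¹ • M.factorSum p.1 p.2 ω := by
  rw [lamTilde, timeMean, factorSum, smul_smul, inv_natCast_eq_inv_sqrt]

theorem tendsto_lim_inv_sqrt :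
    Tendsto (fun x : Σ p, M.space p => (Real.sqrt x.1.2)⁻¹) M.lim (𝓝 0) :=
  M.tendsto_lim_snd (fun n => (Real.sqrt n)⁻¹) tendsto_inv_sqrt

theorem Factors.tendsto_lamTilde (hF : M.Factors SF OmF OmvF P' Z η ηv) :
    Tendsto (fun x : Σ p, M.space p => (M.lamTilde x.1.1 x.1.2 x.2).ofLp) M.lim
      (𝓝 M.lam.ofLp) := by
  refine tendsto_pi_nhds.2 fun a => ?_
  have h := (hF.stochBounded_factorSum a _ tendsto_lim_inv_sqrt).const_add (M.lam a)
  rw [add_zero] at h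
  refine h.congr fun x => ?_
  rw [lamTilde_eq x.1 x.2, PiLp.add_apply, PiLp.smul_apply, smul_eq_mul, mul_comm]

theorem Loadings.tendsto_lim (hL : M.Loadings Γ) :
    Tendsto (fun x : Σ p, M.space p =>
      (x.1.1 : ℝ)⁻¹ • ((M.loadMat x.1.1 x.1.2)ᵀ * M.loadMat x.1.1 x.1.2)) M.lim (𝓝 Γ) := by
  refine (hL.tendsto.comp (tendsto_fst_inProb (Ω := M.space) (P := M.prob))).congr fun x => ?_
  rw [Function.comp_apply, sum_outer_loadMat]

theorem Loadings.isUnit_det (hL : M.Loadings Γ) : IsUnit Γ.toBlocks₁₁.det := by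
  have h : Γ.toBlocks₁₁.PosDef := hL.posDef.submatrix Sum.inl_injective
  exact h.det_pos.ne'.isUnit

/-- The two-pass estimator equals the ex-post risk premia up to the effect of the missing
factors, asymptotically. -/
theorem tendsto_scaledTP_sub (hF : M.Factors SF OmF OmvF P' Z η ηv) (hL : M.Loadings Γ)
    (hE : M.Errors) :
    Tendsto (fun x : Σ p, M.space p => M.scaledTP x.1 x.2 - (ovLimit Γ M.lam
      (M.etaT SF x.1.1 x.1.2 x.2) (M.etavT x.1.1 x.1.2 x.2) + M.factorSum x.1.1 x.1.2 x.2))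
      M.lim (𝓝 0) := by
  have hq := M.tendsto_loadMat_errCov hE
  have hK := M.tendsto_errCov_errCov hE
  have hp := M.tendsto_loadMat_errBar hE
  have hr := M.tendsto_errCov_errBar hE
  have hS := hF.tendsto_sampleCov
  obtain ⟨hdet, hlim⟩ := tendsto_scaledError tendsto_lim_inv_sqrt hS hF.full_rank hF.transpose_eq
    hF.stochBounded_etaT hF.stochBounded_etavT hL.tendsto_lim hL.isUnit_det hq hK hp hr
    hF.tendsto_lamTilde
  have := ((PiLp.continuous_toLp 2 _).tendsto _).comp hlim
  refine Tendsto.congr' ?_ this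
  -- On events of probability tending to one, both passes have invertible moment matrices and the
  -- expansion is an equality.
  filter_upwards [hdet, eventually_isUnit_det hS hF.full_rank, M.eventually_lim_pos]
    with x hdet hSx hpos
  obtain ⟨⟨N, T⟩, ω⟩ := x
  obtain ⟨hN, hT⟩ := hpos
  have hsT : Real.sqrt T ≠ 0 := (Real.sqrt_pos.2 (by exact_mod_cast hT)).ne'
  have key := twoPass_expansion (G := M.loadMat N T) (E := M.errMat N T ω)
    (R := Matrix.of (M.rs N T ω)) (D := M.demMat N T ω) (V := M.missMat N T ω)
    (lt := (M.lamTilde N T ω).ofLp) (s := Real.sqrt T) (w := (Real.sqrt T)⁻¹) (c := (N : ℝ)⁻¹)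
    (mul_inv_cancel₀ hsT)
    (by rw [Fintype.card_fin, ← inv_natCast_eq_inv_sqrt,
      inv_mul_cancel₀ (by exact_mod_cast hT.ne')])
    (M.transpose_demMat_mulVec_one hT N ω) (returns_eq (hF.stationary N T) ω)
    (S := M.sampleCov N T ω) rfl hSx (SF := SF) (η := M.etaT SF N T ω)
    (by
      -- The Σ_F⁻¹ in the definition of η_T cancels here, leaving T^{-1/2} V'D.
      rw [← transpose_mul, etaT_eq, Matrix.mul_smul, mul_nonsing_inv_cancel_left _ _ hF.full_rank,
        transpose_smul, transpose_mul, transpose_transpose])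
    (B := M.betaMat N T ω) rfl rfl
    (q := Real.sqrt T • ((N : ℝ)⁻¹ • ((M.loadMat N T)ᵀ * M.errCov N T ω)))
    (by rw [errCov, inv_natCast_eq_inv_sqrt T])
    (K := Real.sqrt T • ((N : ℝ)⁻¹ • ((M.errCov N T ω)ᵀ * M.errCov N T ω)))
    (by rw [errCov, inv_natCast_eq_inv_sqrt T])
    (p := Real.sqrt T • ((N : ℝ)⁻¹ • ((M.loadMat N T)ᵀ *ᵥ M.errBar N T ω)))
    (by rw [errBar, inv_natCast_eq_inv_sqrt T])
    (r := Real.sqrt T • ((N : ℝ)⁻¹ • ((M.errCov N T ω)ᵀ *ᵥ M.errBar N T ω)))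
    (by rw [errCov, errBar, inv_natCast_eq_inv_sqrt T]) hdet
  rw [← ofLp_lamTP ω hSx, ← ofLp_etavT] at key
  have hsplit : M.scaledTP (N, T) ω = Real.sqrt T • (M.lamTP N T ω - M.lamTilde N T ω)
      + M.factorSum N T ω := by
    rw [← scaledTilde_eq M (N, T) ω, scaledTP, scaledTilde, ← smul_add, sub_add_sub_cancel]
  simp only [Function.comp_apply, hsplit, add_sub_add_right_eq_sub]
  rw [← key]
  rfl

end FactorModel

/-- Convergence in distribution depends on the limit only through its law. -/
theorem tendstoInDistribution_id_of_hasLaw {ι : Type*} {Ω : ι → Type*} [∀ n, MeasurableSpace (Ω n)]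
    {P : ∀ n, Measure (Ω n)} [∀ n, IsProbabilityMeasure (P n)] {l : Filter ι} {E : Type*}
    [TopologicalSpace E] [MeasurableSpace E] [OpensMeasurableSpace E] {X : ∀ n, Ω n → E}
    {Ω' : Type*} [MeasurableSpace Ω'] {P' : Measure Ω'} [IsProbabilityMeasure P'] {Z : Ω' → E}
    {ν : Measure E} [IsProbabilityMeasure ν] (h : TendstoInDistribution X l Z P P')
    (hZ : HasLaw Z ν P') : TendstoInDistribution X l id P ν where
  forall_aemeasurable := h.forall_aemeasurable
  aemeasurable_limit := aemeasurable_id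
  tendsto := by
    have := h.tendsto
    simpa only [hZ.map_eq, Measure.map_id] using this

/-! ### Limit laws, their mean, and the case without missing factors -/

namespace FactorModel

open Matrix

variable {kF kv : ℕ} {M : FactorModel kF kv} {SF OmF : Matrix (Fin kF) (Fin kF) ℝ}
  {OmvF : Matrix (Fin kv × Fin kF) (Fin kv × Fin kF) ℝ}
  {Γ : Matrix (Fin kF ⊕ Fin kv) (Fin kF ⊕ Fin kv) ℝ}
  {Ω' : Type*} [MeasurableSpace Ω'] {P' : Measure Ω'} [IsProbabilityMeasure P']
  {Z : Ω' → Vec kF} {η : Ω' → Matrix (Fin kF) (Fin kv) ℝ} {ηv : Ω' → Vec kv}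

/-- The approximating variable is a continuous function of the jointly convergent triple; Slutsky's
lemma passes its limit on to the estimator. -/
theorem tendstoInDistribution_scaledTP (hF : M.Factors SF OmF OmvF P' Z η ηv)
    (hL : M.Loadings Γ) (hE : M.Errors) :
    TendstoInDistribution M.scaledTP atTop (fun ω => ovLimit Γ M.lam (η ω) (ηv ω) + Z ω)
      M.prob P' := by
  have hc : Continuous fun z : Vec kF × EuclideanSpace ℝ (Fin kv × Fin kF) × Vec kv =>
      ovMap Γ M.lam z.2 + z.1 := by fun_prop
  have h1 := hF.joint.continuous_comp hc
  refine tendstoInDistribution_of_sub (Ω := M.space) (P := M.prob)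
    (X := fun p ω => ovLimit Γ M.lam (M.etaT SF p.1 p.2 ω) (M.etavT p.1 p.2 ω)
      + M.factorSum p.1 p.2 ω) h1 (fun p => (M.measurable_scaledTP p).aemeasurable) ?_
  exact (tendstoInProb_iff (Ω := M.space) (P := M.prob) (X := fun p ω => M.scaledTP p ω -
    (ovLimit Γ M.lam (M.etaT SF p.1 p.2 ω) (M.etavT p.1 p.2 ω) + M.factorSum p.1 p.2 ω))).2
    (tendsto_scaledTP_sub hF hL hE)

theorem Factors.tendstoInDistribution_scaledTilde (hF : M.Factors SF OmF OmvF P' Z η ηv) :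
    TendstoInDistribution M.scaledTilde atTop Z M.prob P' := by
  have h1 := hF.joint.continuous_comp (g := fun z => z.1) continuous_fst
  have h2 : M.scaledTilde = fun p ω => M.factorSum p.1 p.2 ω :=
    funext fun p => funext fun ω => M.scaledTilde_eq p ω
  rw [h2]
  exact h1

theorem Factors.integrable_ovLimit (hF : M.Factors SF OmF OmvF P' Z η ηv) (lam : Vec kF) :
    Integrable (fun ω => ovLimit Γ lam (η ω) (ηv ω)) P' :=
  ContinuousLinearMap.integrable_comp (ovMap Γ lam)
    (φ := fun ω => ((WithLp.toLp 2 (η ω).vec : EuclideanSpace ℝ (Fin kv × Fin kF)), ηv ω))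
    (hF.law_eta.hasGaussianLaw.integrable.prodMk hF.law_etav.hasGaussianLaw.integrable)

/-- The limit is linear in (η, ηv), so its mean depends on the two marginal laws alone and no joint
Gaussianity is needed. -/
theorem Factors.integral_ovLimit (hF : M.Factors SF OmF OmvF P' Z η ηv) (lam : Vec kF) :
    ∫ ω, ovLimit Γ lam (η ω) (ηv ω) ∂P' = 0 := by
  have hη := hF.law_eta.hasGaussianLaw.integrable
  have hv := hF.law_etav.hasGaussianLaw.integrable
  have h1 := (ovMap Γ lam).integral_comp_comm (hη.prodMk hv)
  have h2 : ∫ ω, ((WithLp.toLp 2 (η ω).vec : EuclideanSpace ℝ (Fin kv × Fin kF)), ηv ω) ∂P'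
      = 0 := by
    rw [integral_pair hη hv, hF.law_eta.integral_eq, hF.law_etav.integral_eq,
      integral_id_multivariateGaussian, integral_id_multivariateGaussian, Prod.mk_zero_zero]
  rw [h2, map_zero] at h1
  exact h1

/-- Positive definiteness of the limit of the second moments of the loadings leaves no room for
missing factors with zero loadings. -/
theorem Loadings.isEmpty_of_forall_eq_zero (hL : M.Loadings Γ) (hμ : ∀ N T i, M.μ N T i = 0) :
    IsEmpty (Fin kv) := by
  refine ⟨fun b => ?_⟩
  -- A diagonal entry of Γ belonging to a missing factor would be a limit of zeros, yet positive
  -- definiteness makes it positive.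
  have h1 := tendsto_pi_nhds.1 (tendsto_pi_nhds.1 hL.tendsto (Sum.inr b)) (Sum.inr b)
  have h2 : (fun p : ℕ × ℕ => ((p.1 : ℝ)⁻¹ • ∑ i, outer (M.γ p.1 p.2 i) (M.γ p.1 p.2 i))
      (Sum.inr b) (Sum.inr b)) = fun _ => 0 := by
    funext p
    simp [Matrix.sum_apply, outer, vecMulVec_apply, γ, hμ]
  rw [h2] at h1
  have h3 := hL.posDef.diag_pos (i := Sum.inr b)
  rw [← tendsto_nhds_unique tendsto_const_nhds h1] at h3
  exact lt_irrefl _ h3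

theorem tendstoInProb_scaledTP_sub_scaledTilde (hF : M.Factors SF OmF OmvF P' Z η ηv)
    (hL : M.Loadings Γ) (hE : M.Errors) (hμ : ∀ N T i, M.μ N T i = 0) :
    TendstoInProb M.prob (fun p ω => M.scaledTP p ω - M.scaledTilde p ω) atTop 0 := by
  have := hL.isEmpty_of_forall_eq_zero hμ
  refine tendstoInProb_iff.2 ((tendsto_scaledTP_sub hF hL hE).congr fun x => ?_)
  have h0 : ovLimit Γ M.lam (M.etaT SF x.1.1 x.1.2 x.2) (M.etavT x.1.1 x.1.2 x.2) = 0 := by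
    ext a
    simp [ovLimit, act, mulVec, dotProduct]
  rw [h0, zero_add, scaledTilde_eq]

end FactorModel

end TwoPass

theorem corollary1 {kF kv : ℕ} (M : TwoPass.FactorModel kF kv)
    (SF OmF : Matrix (Fin kF) (Fin kF) ℝ)
    (OmvF : Matrix (Fin kv × Fin kF) (Fin kv × Fin kF) ℝ)
    (Γ : Matrix (Fin kF ⊕ Fin kv) (Fin kF ⊕ Fin kv) ℝ)
    {Ω' : Type*} [MeasurableSpace Ω'] (P' : Measure Ω') [IsProbabilityMeasure P']
    (Z : Ω' → TwoPass.Vec kF) (η : Ω' → Matrix (Fin kF) (Fin kv) ℝ) (ηv : Ω' → TwoPass.Vec kv)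
    (hF : M.Factors SF OmF OmvF P' Z η ηv) (hL : M.Loadings Γ) (hE : M.Errors) :
    -- `√T (λ̂_TP - λ) ⇒ Γ_ββ⁻¹ Γ_βμ (ηv - η' λ) + lim √T (λ̃ - λ)`
    TendstoInDistribution M.scaledTP atTop
      (fun ω => TwoPass.ovLimit Γ M.lam (η ω) (ηv ω) + Z ω) M.prob P' ∧
    -- where `lim √T (λ̃ - λ) = Z` is mean-zero Gaussian
    TendstoInDistribution M.scaledTilde atTop Z M.prob P' ∧
    HasLaw Z (multivariateGaussian 0 OmF) P' ∧
    -- the whole limit is integrable with mean zero, and it is Gaussian (and so is its first term)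
    -- if the marginally Gaussian limits `Z`, `η`, `ηv` are jointly Gaussian
    Integrable (fun ω => TwoPass.ovLimit Γ M.lam (η ω) (ηv ω) + Z ω) P' ∧
    ∫ ω, (TwoPass.ovLimit Γ M.lam (η ω) (ηv ω) + Z ω) ∂P' = 0 ∧
    (HasGaussianLaw (fun ω =>
        (Z ω, (WithLp.toLp 2 (η ω).vec : EuclideanSpace ℝ (Fin kv × Fin kF)), ηv ω)) P' →
      HasGaussianLaw (fun ω => TwoPass.ovLimit Γ M.lam (η ω) (ηv ω)) P' ∧
      HasGaussianLaw (fun ω => TwoPass.ovLimit Γ M.lam (η ω) (ηv ω) + Z ω) P') ∧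
    -- without missing factors
    ((∀ N T i, M.μ N T i = 0) →
      TwoPass.TendstoInProb M.prob (fun p ω => M.scaledTP p ω - M.scaledTilde p ω) atTop 0 ∧
      TendstoInDistribution M.scaledTP atTop id M.prob (multivariateGaussian 0 OmF) ∧
      TendstoInDistribution M.scaledTilde atTop id M.prob (multivariateGaussian 0 OmF)) := by
  refine ⟨TwoPass.FactorModel.tendstoInDistribution_scaledTP hF hL hE,
    hF.tendstoInDistribution_scaledTilde, hF.law_Z,
    (hF.integrable_ovLimit M.lam).add hF.law_Z.hasGaussianLaw.integrable, ?_,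
    fun hG => ⟨?_, ?_⟩, fun hμ => ?_⟩
  · rw [integral_add (hF.integrable_ovLimit M.lam) hF.law_Z.hasGaussianLaw.integrable,
      hF.integral_ovLimit, hF.law_Z.integral_eq, integral_id_multivariateGaussian, add_zero]
  · exact hG.map_fun ((TwoPass.ovMap Γ M.lam).comp (ContinuousLinearMap.snd ℝ _ _))
  · exact hG.map_fun ((TwoPass.ovMap Γ M.lam).comp (ContinuousLinearMap.snd ℝ _ _)
      + ContinuousLinearMap.fst ℝ _ _)
  · have h1 := TwoPass.FactorModel.tendstoInProb_scaledTP_sub_scaledTilde hF hL hE hμ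
    have h2 := TwoPass.tendstoInDistribution_of_sub (Ω := M.space) (P := M.prob)
      hF.tendstoInDistribution_scaledTilde (fun p => (M.measurable_scaledTP p).aemeasurable) h1
    exact ⟨h1, TwoPass.tendstoInDistribution_id_of_hasLaw h2 hF.law_Z,
      TwoPass.tendstoInDistribution_id_of_hasLaw hF.tendstoInDistribution_scaledTilde hF.law_Z⟩
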